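/- Let $r\in\mathbb N\cup\{\infty\}$ with $r\ge 2$, let $E:\mathbb S^1\to\mathbb S^1$ be a $\mathscr C^r$ map of the circle $\mathbb S^1=\mathbb R/\mathbb Z$ of degree $\ell\ge 2$ with $E'\ge\lambda$ everywhere for a constant $\lambda>1$, and let $\tau:\mathbb S^1\to\mathbb R$ be of class $\mathscr C^r$. Put $f(x,s)=(E(x),\,s+\tau(x) \bmod 1)$ on $\mathbb T^2=\mathbb S^1\times\mathbb S^1$. Fix $R>\|\tau'\|_\infty$ and let $\mathscr K_R=\{(\xi,\eta)\in\mathbb R^2:|\eta|\le \frac{R}{\lambda-1}|\xi|\}$. For $n\ge 1$ define $$\mathfrak n(\tau,R;n)=\sup_{z}\sup_{v}\#\{\zeta\in f^{-n}(z): v\in Df^n(\zeta)\mathscr K_R\},$$ $$\mathrm{n}(\tau,R;n)=\sup_{z}\sup_{v}\sum_{\substack{\zeta\in f^{-n}(z)\\ v\in Df^n(\zeta)\mathscr K_R}}\frac1{\det Df^n(\zeta)},\qquad \mathrm{m}(\tau,R;n)=\sup_{z}\sup_{w\in f^{-n}(z)}\sum_{\substack{\zeta\in f^{-n}(z)\\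 Df^n(\zeta)\mathscr K_R\cap Df^n(w)\mathscr K_R\ne\{0\}}}\frac1{\det Df^n(\zeta)},$$ where $z$ ranges over $\mathbb T^2$ and $v$ over the unit vectors of $\mathbb R^2$. Put $$\mathrm{m}(\tau)=\limsup_{n\to\infty}\mathrm{m}(\tau,R;n)^{1/n},\qquad \mathrm{n}(\tau)=\limsup_{n\to\infty}\mathrm{n}(\tau,R;n)^{1/n},\qquad \mathfrak n(\tau)=\lim_{n\to\infty}\mathfrak n(\tau,R;n)^{1/n}.$$ Then the last limit exists, and the following are equivalent: 1. $\tau$ is cohomologous to a constant, i.e. $\tau=\varphi\circ E-\varphi+c$ for some $\varphi\in\mathscr C^r(\mathbb S^1)$ and $c\in\mathbb R$; 2. $\mathrm{m}(\tau)=1$; 3. $\mathrm{n}(\tau)=1$; 4. $\mathfrak n(\tau)=\ell$. -/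

import Mathlib

open Filter Topology
open scoped ENNReal

namespace PartialCaptivity

/-- The two-dimensional torus `(ℝ/ℤ) × (ℝ/ℤ)`. -/
abbrev Torus : Type := UnitAddCircle × UnitAddCircle

/-- The point of the torus represented by a point of the plane. -/
def toTorus (u : ℝ × ℝ) : Torus := ((u.1 : UnitAddCircle), (u.2 : UnitAddCircle))

/-- The representative in `[-1/2, 1/2)` of a point of `ℝ/ℤ`. -/
noncomputable def centeredRep (y : UnitAddCircle) : ℝ :=
  (AddCircle.equivIco (1 : ℝ) (-1 / 2) y : ℝ)

/-- The derivative `Dg(z) : ℝ² → ℝ²` of a self-map `g` of the torus at `z`, computed in the local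
coordinates `u ↦ z + u` at `z` and `u ↦ g z + u` at `g z`. -/
noncomputable def torusDeriv (g : Torus → Torus) (z : Torus) : (ℝ × ℝ) →L[ℝ] (ℝ × ℝ) :=
  fderiv ℝ (fun u : ℝ × ℝ =>
    (centeredRep (g (z + toTorus u) - g z).1, centeredRep (g (z + toTorus u) - g z).2)) 0

/-- `φ : ℝ/ℤ → ℝ` is of class `C^r`. -/
def IsCr (r : ℕ∞) (φ : UnitAddCircle → ℝ) : Prop :=
  ContDiff ℝ r (fun t : ℝ => φ (t : UnitAddCircle))

/-- `E : ℝ/ℤ → ℝ/ℤ` is of class `C^r`, has degree `ℓ`, and satisfies `E' ≥ lam` everywhere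
(expressed through a lift of `E` to the real line). With `1 < lam` this says that `E` is an
(orientation preserving) expanding map. -/
def IsExpandingMap (r : ℕ∞) (ℓ : ℕ) (lam : ℝ) (E : UnitAddCircle → UnitAddCircle) : Prop :=
  ∃ F : ℝ → ℝ, ContDiff ℝ r F ∧ (∀ t : ℝ, F (t + 1) = F t + ℓ) ∧
    (∀ t : ℝ, E (t : UnitAddCircle) = (F t : UnitAddCircle)) ∧ ∀ t : ℝ, lam ≤ deriv F t

/-- The sup norm `‖τ'‖_∞` of the derivative of `τ : ℝ/ℤ → ℝ`. -/
noncomputable def derivSupNorm (τ : UnitAddCircle → ℝ) : ℝ :=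
  ⨆ t : ℝ, |deriv (fun s : ℝ => τ (s : UnitAddCircle)) t|

/-- The compact group extension `f(x, s) = (E x, s + τ x mod 1)`. -/
noncomputable def skewProduct (E : UnitAddCircle → UnitAddCircle) (τ : UnitAddCircle → ℝ) :
    Torus → Torus :=
  fun z => (E z.1, z.2 + (τ z.1 : UnitAddCircle))

/-- `τ = φ ∘ E - φ + c` for some `φ` of class `C^r` on the circle and some constant `c`. -/
def IsCohomologousToConst (r : ℕ∞) (E : UnitAddCircle → UnitAddCircle)
    (τ : UnitAddCircle → ℝ) : Prop :=
  ∃ φ : UnitAddCircle → ℝ, IsCr r φ ∧ ∃ c : ℝ, ∀ x, τ x = φ (E x) - φ x + c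

/-- The cone `{(ξ, η) : |η| ≤ ϑ |ξ|}` with `ϑ = R / (lam - 1)`. -/
def cone (lam R : ℝ) : Set (ℝ × ℝ) := {p | |p.2| ≤ R / (lam - 1) * |p.1|}

/-- The image `Df^n(ζ) K_R` of the cone under the derivative at `ζ` of the `n`-th iterate. -/
noncomputable def imageCone (f : Torus → Torus) (lam R : ℝ) (n : ℕ) (ζ : Torus) :
    Set (ℝ × ℝ) :=
  torusDeriv (f^[n]) ζ '' cone lam R

/-- The weight `1 / det Df^n(ζ)`. -/
noncomputable def weight (f : Torus → Torus) (n : ℕ) (ζ : Torus) : ℝ≥0∞ :=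
  ENNReal.ofReal (1 / (torusDeriv (f^[n]) ζ).det)

/-- The maximal number of points `ζ` of a fibre `f^{-n}(z)` whose image cones contain a common
unit vector `v`. -/
noncomputable def coneCount (f : Torus → Torus) (lam R : ℝ) (n : ℕ) : ℕ∞ :=
  ⨆ (z : Torus) (v : ℝ × ℝ) (_ : v.1 ^ 2 + v.2 ^ 2 = 1),
    {ζ : Torus | f^[n] ζ = z ∧ v ∈ imageCone f lam R n ζ}.encard

/-- The supremum over `z` and unit vectors `v` of the sum of `1 / det Df^n(ζ)` over the points
`ζ ∈ f^{-n}(z)` whose image cones contain `v`. -/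
noncomputable def weightedConeSum (f : Torus → Torus) (lam R : ℝ) (n : ℕ) : ℝ≥0∞ :=
  ⨆ (z : Torus) (v : ℝ × ℝ) (_ : v.1 ^ 2 + v.2 ^ 2 = 1),
    ∑' ζ : {ζ : Torus // f^[n] ζ = z ∧ v ∈ imageCone f lam R n ζ}, weight f n ζ

/-- The supremum over `z` and `w ∈ f^{-n}(z)` of the sum of `1 / det Df^n(ζ)` over the points
`ζ ∈ f^{-n}(z)` that are not transversal to `w`, that is, whose image cone meets that of `w`
outside the origin. -/
noncomputable def nonTransversalSum (f : Torus → Torus) (lam R : ℝ) (n : ℕ) : ℝ≥0∞ :=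
  ⨆ (z : Torus) (w : Torus) (_ : f^[n] w = z),
    ∑' ζ : {ζ : Torus // f^[n] ζ = z ∧ imageCone f lam R n ζ ∩ imageCone f lam R n w ≠ {0}},
      weight f n ζ

/-- `m(τ)`, the exponential growth rate of `nonTransversalSum`. -/
noncomputable def nonTransversalRate (f : Torus → Torus) (lam R : ℝ) : ℝ≥0∞ :=
  limsup (fun n : ℕ => nonTransversalSum f lam R n ^ (1 / (n : ℝ))) atTop

/-- `n(τ)` (weighted), the exponential growth rate of `weightedConeSum`. -/
noncomputable def weightedConeRate (f : Torus → Torus) (lam R : ℝ) : ℝ≥0∞ :=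
  limsup (fun n : ℕ => weightedConeSum f lam R n ^ (1 / (n : ℝ))) atTop

/-- `n(τ)` (unweighted), the limit of the `n`-th roots of `coneCount`. -/
noncomputable def coneCountRate (f : Torus → Torus) (lam R : ℝ) : ℝ≥0∞ :=
  limUnder atTop (fun n : ℕ => (coneCount f lam R n : ℝ≥0∞) ^ (1 / (n : ℝ)))

/-- On reals in `[-1/2, 1/2)` the centered representative is the identity. -/
theorem centeredRep_coe {t : ℝ} (h : t ∈ Set.Ico (-1 / 2 : ℝ) (1 / 2)) :
    centeredRep (t : UnitAddCircle) = t := by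
  have h' : t ∈ Set.Ico (-1 / 2 : ℝ) (-1 / 2 + 1) := ⟨h.1, by have := h.2; linarith⟩
  exact AddCircle.equivIco_coe_of_mem (p := (1 : ℝ)) h'

/-- The derivative of a torus map is the usual derivative of any lift to the plane. -/
theorem torusDeriv_eq_fderiv_lift {g : Torus → Torus} {G : ℝ × ℝ → ℝ × ℝ}
    (hG : ∀ u, g (toTorus u) = toTorus (G u)) {p : ℝ × ℝ} (hc : ContinuousAt G p) :
    torusDeriv g (toTorus p) = fderiv ℝ G p := by
  have h1 : (fun u : ℝ × ℝ =>
      (centeredRep (g (toTorus p + toTorus u) - g (toTorus p)).1,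
        centeredRep (g (toTorus p + toTorus u) - g (toTorus p)).2))
      =ᶠ[𝓝 0] fun u => G (p + u) - G p := by
    have hc' : Tendsto (fun u : ℝ × ℝ => G (p + u) - G p) (𝓝 0) (𝓝 0) := by
      have : Tendsto (fun u : ℝ × ℝ => p + u) (𝓝 0) (𝓝 p) := by
        have h : Continuous fun u : ℝ × ℝ => p + u := by fun_prop
        simpa using h.tendsto 0
      simpa using (hc.tendsto.comp this).sub_const (G p)
    filter_upwards [hc'.eventually (Metric.ball_mem_nhds 0 (show (0 : ℝ) < 1 / 2 by norm_num))]
      with u hu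
    rw [dist_zero_right, Prod.norm_def, max_lt_iff, Real.norm_eq_abs,
      Real.norm_eq_abs, abs_lt, abs_lt] at hu
    have e : toTorus p + toTorus u = toTorus (p + u) := by
      simp [toTorus]
    rw [e, hG, hG]
    have e1 : (toTorus (G (p + u)) - toTorus (G p)).1
        = (((G (p + u) - G p).1 : ℝ) : UnitAddCircle) := by simp [toTorus]
    have e2 : (toTorus (G (p + u)) - toTorus (G p)).2
        = (((G (p + u) - G p).2 : ℝ) : UnitAddCircle) := by simp [toTorus]
    rw [e1, e2, centeredRep_coe ⟨by linarith [hu.1.1], hu.1.2⟩,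
      centeredRep_coe ⟨by linarith [hu.2.1], hu.2.2⟩]
  unfold torusDeriv
  rw [h1.fderiv_eq, fderiv_sub_const, fderiv_comp_add_left, add_zero]

end PartialCaptivity

/-! `Df^n` is a shear depending only on the base point, so slopes suffice. The slope `σ` at `E^[n]
y` lies in the image cone of a point over `y` iff its pull-back, under the affine cocycle `σ ↦ E' σ
- τ'`, has modulus at most `θ = R / (lam - 1)`. Since `|τ'| ≤ θ (lam - 1)`, slopes outside the cone
stay outside under pull-back. Hence cone sums factor over blocks (`coneSum_add`), and Fekete's lemma
gives the limit of the counts.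

Condition 1 is equivalent to the existence of a bounded slope field with `a = E' · a ∘ E - τ'`. The
derivative of `φ` is such a field, and a maximum argument puts it in the cone. Conversely, along the
inverse lift the equation is contracting, so bounded solutions are smooth and integrate to `φ`
(`LiftPair.isCohomologousToConst_of_slope`). A compactness argument (`LiftPair.exists_slope`)
produces the field as soon as, for every `N`, some slope over some point pulls back into all cones
of its level-`N` fibre.

Given the field, no preimage is ever lost: the count is `ℓ ^ n`, and the weighted sums are full
iterates of the transfer operator with weight `1 / E'`, which are bounded above and below by
distortion. Without it, some level `N` loses a preimage for every point and slope. Then the count at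
level `N` is at most `ℓ ^ N - 1`, so its rate is below `ℓ`. In the weighted case the loss is a
definite fraction of a positive supersolution of the transfer operator, so cone sums decay
geometrically (`exists_coneSum_contraction`). This also holds for aperture `θ + 1`, which absorbs
the difference between sharing a slope with a moving `w` and containing one fixed slope; hence m(τ)
< 1 (`nonTransversal_fiberSum_le`). -/

namespace PartialCaptivity

/-! ### Affine slope cocycles and cone-restricted transfer sums -/

section Cocycles

variable {X : Type*}

/-- The multiplicative cocycle `w y * w (E y) * ⋯ * w (E^[n-1] y)`. -/
def cocycle {M : Type*} [CommMonoid M] (E : X → X) (w : X → M) : ℕ → X → M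
  | 0, _ => 1
  | n + 1, y => w y * cocycle E w n (E y)

/-- A slope at `E^[n] y`, pulled back to `y` by the cocycle of affine maps `σ ↦ d y * σ - b y`. -/
def pull (E : X → X) (d b : X → ℝ) : ℕ → X → ℝ → ℝ
  | 0, _, σ => σ
  | n + 1, y, σ => d y * pull E d b n (E y) σ - b y

theorem cocycle_add {M : Type*} [CommMonoid M] (E : X → X) (w : X → M) (m n : ℕ) (y : X) :
    cocycle E w (m + n) y = cocycle E w n y * cocycle E w m (E^[n] y) := by
  induction n generalizing y with
  | zero => simp [cocycle]
  | succ n ih => rw [← add_assoc, cocycle, ih, cocycle, Function.iterate_succ_apply, mul_assoc]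

theorem cocycle_one {M : Type*} [CommMonoid M] (E : X → X) (n : ℕ) (y : X) :
    cocycle E (fun _ => (1 : M)) n y = 1 := by
  induction n generalizing y with
  | zero => rfl
  | succ n ih => rw [cocycle, ih, one_mul]

theorem pull_add (E : X → X) (d b : X → ℝ) (m n : ℕ) (y : X) (σ : ℝ) :
    pull E d b (m + n) y σ = pull E d b n y (pull E d b m (E^[n] y) σ) := by
  induction n generalizing y with
  | zero => rfl
  | succ n ih => rw [← add_assoc, pull, ih, pull, Function.iterate_succ_apply]

theorem pull_sub_pull (E : X → X) (d b : X → ℝ) (n : ℕ) (y : X) (σ σ' : ℝ) :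
    pull E d b n y σ - pull E d b n y σ' = cocycle E d n y * (σ - σ') := by
  induction n generalizing y with
  | zero => simp [pull, cocycle]
  | succ n ih =>
    rw [pull, pull, cocycle, mul_assoc, ← ih]
    ring

variable {E : X → X} {d b : X → ℝ} {lam θ : ℝ}

theorem pow_le_cocycle (hlam : 0 ≤ lam) (hd : ∀ y, lam ≤ d y) (n : ℕ) (y : X) :
    lam ^ n ≤ cocycle E d n y := by
  induction n generalizing y with
  | zero => simp [cocycle]
  | succ n ih =>
    rw [cocycle, pow_succ']
    exact mul_le_mul (hd y) (ih _) (pow_nonneg hlam n) (hlam.trans (hd y))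

theorem cocycle_pos (hlam : 0 < lam) (hd : ∀ y, lam ≤ d y) (n : ℕ) (y : X) :
    0 < cocycle E d n y :=
  (pow_pos hlam n).trans_le (pow_le_cocycle hlam.le hd n y)

theorem cocycle_le_pow {Λ : ℝ} (hd0 : ∀ y, 0 ≤ d y) (hd : ∀ y, d y ≤ Λ) (n : ℕ) (y : X) :
    cocycle E d n y ≤ Λ ^ n := by
  have h0 : ∀ n y, 0 ≤ cocycle E d n y := by
    intro n
    induction n with
    | zero => simp [cocycle]
    | succ n ih => exact fun y => mul_nonneg (hd0 y) (ih _)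
  induction n generalizing y with
  | zero => simp [cocycle]
  | succ n ih =>
    rw [cocycle, pow_succ']
    exact mul_le_mul (hd y) (ih _) (h0 _ _) ((hd0 y).trans (hd y))

theorem ofReal_one_div_cocycle (hd : ∀ y, 0 < d y) (n : ℕ) (y : X) :
    ENNReal.ofReal (1 / cocycle E d n y)
      = cocycle E (fun y => ENNReal.ofReal (1 / d y)) n y := by
  induction n generalizing y with
  | zero => simp [cocycle]
  | succ n ih =>
    rw [cocycle, cocycle, ← ih, ← ENNReal.ofReal_mul (one_div_nonneg.2 (hd y).le),
      one_div_mul_one_div]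

theorem exists_pull_eq_zero (hlam : 0 < lam) (hd : ∀ y, lam ≤ d y) (n : ℕ) (y : X) :
    ∃ σ, pull E d b n y σ = 0 := by
  have h := pull_sub_pull E d b n y (-(pull E d b n y 0 / cocycle E d n y)) 0
  have hc := (cocycle_pos (E := E) hlam hd n y).ne'
  refine ⟨-(pull E d b n y 0 / cocycle E d n y), ?_⟩
  field_simp at h
  linarith

/-- If `|s| > θ`, then `|d s - b| > lam θ - θ (lam - 1) = θ`: the complement of the cone is
invariant under pull-back. A slope that ends in the cone was therefore in it at every intermediate
level. -/
theorem abs_pull_le_of_add (hlam : 1 < lam) (hd : ∀ y, lam ≤ d y)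
    (hb : ∀ y, |b y| ≤ θ * (lam - 1)) {m n : ℕ} {y : X} {σ : ℝ}
    (h : |pull E d b (m + n) y σ| ≤ θ) : |pull E d b m (E^[n] y) σ| ≤ θ := by
  induction n generalizing y with
  | zero => exact h
  | succ n ih =>
    rw [Function.iterate_succ_apply]
    apply ih
    rw [← add_assoc, pull] at h
    set s := pull E d b (m + n) (E y) σ
    by_contra! hs
    have h1 := hb y
    have h2 := hd y
    have h3 : |d y * s| ≤ |d y * s - b y| + |b y| := by
      simpa using abs_add_le (d y * s - b y) (b y)
    rw [abs_mul, abs_of_pos (by linarith)] at h3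
    nlinarith [abs_nonneg s]

open Classical in
/-- The sum of `w_n(y) u(y)` over the points `y ∈ E^{-n}(x)` satisfying `P`. -/
noncomputable def fiberSum (E : X → X) (w : X → ℝ≥0∞) (n : ℕ) (P : X → Prop) (u : X → ℝ≥0∞)
    (x : X) : ℝ≥0∞ :=
  ∑' y, if E^[n] y = x ∧ P y then cocycle E w n y * u y else 0

theorem fiberSum_mono {w : X → ℝ≥0∞} {n : ℕ} {P Q : X → Prop} {u v : X → ℝ≥0∞} {x : X}
    (hPQ : ∀ y, E^[n] y = x → P y → Q y) (huv : ∀ y, u y ≤ v y) :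
    fiberSum E w n P u x ≤ fiberSum E w n Q v x := by
  refine ENNReal.tsum_le_tsum fun y => ?_
  by_cases h : E^[n] y = x ∧ P y
  · rw [if_pos h, if_pos ⟨h.1, hPQ y h.1 h.2⟩]
    gcongr
    exact huv y
  · rw [if_neg h]
    exact zero_le

theorem fiberSum_mul_const (w : X → ℝ≥0∞) (n : ℕ) (P : X → Prop) (u : X → ℝ≥0∞) (c : ℝ≥0∞)
    (x : X) : fiberSum E w n P (fun y => u y * c) x = fiberSum E w n P u x * c := by
  rw [fiberSum, fiberSum, ← ENNReal.tsum_mul_right]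
  refine tsum_congr fun y => ?_
  split_ifs <;> simp [mul_assoc]

theorem fiberSum_add (w : X → ℝ≥0∞) (m n : ℕ) (P : X → Prop) (Q : X → X → Prop)
    (u : X → ℝ≥0∞) (x : X) :
    fiberSum E w (m + n) (fun y => P (E^[n] y) ∧ Q (E^[n] y) y) u x
      = fiberSum E w m P (fun y' => fiberSum E w n (Q y') u y') x := by
  classical
  simp only [fiberSum]
  have h : ∀ y', (if E^[m] y' = x ∧ P y' then cocycle E w m y' *
        (∑' y, if E^[n] y = y' ∧ Q y' y then cocycle E w n y * u y else 0) else 0)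
      = ∑' y, if E^[n] y = y' then (if E^[m] y' = x ∧ P y' ∧ Q y' y then
          cocycle E w m y' * (cocycle E w n y * u y) else 0) else 0 := by
    intro y'
    split_ifs with h
    · rw [← ENNReal.tsum_mul_left]
      refine tsum_congr fun y => ?_
      by_cases h1 : E^[n] y = y' <;> by_cases h2 : Q y' y <;> simp [h1, h2, h]
    · symm
      rw [ENNReal.tsum_eq_zero]
      intro y
      split_ifs with h1 h2
      · exact absurd ⟨h2.1, h2.2.1⟩ h
      · rfl
      · rfl
  simp_rw [h]
  -- After the exchange, the only `y'` contributing for a given `y` is `E^[n] y`.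
  rw [ENNReal.tsum_comm]
  refine tsum_congr fun y => ?_
  rw [tsum_eq_single (E^[n] y) (fun y' hy' => if_neg (Ne.symm hy')), if_pos rfl,
    Function.iterate_add_apply, cocycle_add]
  split_ifs
  · ring
  · rfl

/-- The sum of `w_n(y) u(y)` over the points `y ∈ E^{-n}(x)` at which the slope `σ` pulls back
into the cone of aperture `θ`. -/
noncomputable def coneSum (E : X → X) (w : X → ℝ≥0∞) (d b : X → ℝ) (θ : ℝ) (n : ℕ)
    (u : X → ℝ≥0∞) (x : X) (σ : ℝ) : ℝ≥0∞ :=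
  fiberSum E w n (fun y => |pull E d b n y σ| ≤ θ) u x

/-- The cone condition at the intermediate level comes for free from `abs_pull_le_of_add`, so the
sum over long branches splits exactly. -/
theorem coneSum_add (hlam : 1 < lam) (hd : ∀ y, lam ≤ d y)
    (hb : ∀ y, |b y| ≤ θ * (lam - 1)) (w : X → ℝ≥0∞) (m n : ℕ) (u : X → ℝ≥0∞) (x : X) (σ : ℝ) :
    coneSum E w d b θ (m + n) u x σ
      = fiberSum E w m (fun y => |pull E d b m y σ| ≤ θ)
          (fun y => coneSum E w d b θ n u y (pull E d b m y σ)) x := by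
  simp only [coneSum]
  rw [← fiberSum_add w m n _ (fun y' y => |pull E d b n y (pull E d b m y' σ)| ≤ θ)]
  congr 1
  ext y
  rw [pull_add]
  refine ⟨fun h => ⟨abs_pull_le_of_add (n := n) hlam hd hb ?_, h⟩, fun h => h.2⟩
  rwa [pull_add]

/-- If one block of length `N` contracts `u` by the factor `q`, then `k` blocks contract `u` by
the factor `q ^ k`. -/
theorem coneSum_mul_le (hlam : 1 < lam) (hd : ∀ y, lam ≤ d y)
    (hb : ∀ y, |b y| ≤ θ * (lam - 1)) {w : X → ℝ≥0∞} {N : ℕ} {u : X → ℝ≥0∞} {q : ℝ≥0∞}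
    (h : ∀ x σ, coneSum E w d b θ N u x σ ≤ u x * q) (k : ℕ) (x : X) (σ : ℝ) :
    coneSum E w d b θ (k * N) u x σ ≤ u x * q ^ k := by
  induction k generalizing x σ with
  | zero =>
    rw [zero_mul, coneSum, fiberSum, tsum_eq_single x]
    · simp only [cocycle]
      split_ifs <;> simp
    · intro y hy
      rw [if_neg (fun h => hy h.1)]
  | succ k ih =>
    rw [add_mul, one_mul, add_comm, coneSum_add hlam hd hb]
    calc _ ≤ fiberSum E w N (fun y => |pull E d b N y σ| ≤ θ) (fun y => u y * q ^ k) x :=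
          fiberSum_mono (fun _ _ h => h) fun y => ih y _
      _ = coneSum E w d b θ N u x σ * q ^ k := fiberSum_mul_const ..
      _ ≤ u x * q * q ^ k := by gcongr; exact h x σ
      _ = u x * q ^ (k + 1) := by ring

theorem coneSum_one_add_le (hlam : 1 < lam) (hd : ∀ y, lam ≤ d y)
    (hb : ∀ y, |b y| ≤ θ * (lam - 1)) {w : X → ℝ≥0∞} (m n : ℕ) :
    ⨆ (x) (σ), coneSum E w d b θ (m + n) 1 x σ
      ≤ (⨆ (x) (σ), coneSum E w d b θ m 1 x σ) * ⨆ (x) (σ), coneSum E w d b θ n 1 x σ := by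
  refine iSup₂_le fun x σ => ?_
  rw [coneSum_add hlam hd hb]
  calc _ ≤ fiberSum E w m (fun y => |pull E d b m y σ| ≤ θ)
          (fun y => 1 * ⨆ (x) (σ), coneSum E w d b θ n 1 x σ) x :=
        fiberSum_mono (fun _ _ h => h) fun y => by
          rw [one_mul]
          exact le_iSup₂ (f := fun x σ => coneSum E w d b θ n 1 x σ) y _
    _ = coneSum E w d b θ m 1 x σ * _ := fiberSum_mul_const ..
    _ ≤ _ := by
      gcongr
      exact le_iSup₂ (f := fun x σ => coneSum E w d b θ m 1 x σ) x σ

theorem fiberSum_true_add (w : X → ℝ≥0∞) (m n : ℕ) (u : X → ℝ≥0∞) (x : X) :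
    fiberSum E w (m + n) (fun _ => True) u x
      = fiberSum E w m (fun _ => True) (fun y => fiberSum E w n (fun _ => True) u y) x := by
  rw [← fiberSum_add w m n (fun _ => True) (fun _ _ => True)]
  simp

/-- Fatou's lemma for counting measure on the discrete σ-algebra. -/
theorem fiberSum_liminf_le (w : X → ℝ≥0∞) (n : ℕ) (P : X → Prop) (v : ℕ → X → ℝ≥0∞) (x : X) :
    fiberSum E w n P (fun y => liminf (fun k => v k y) atTop) x
      ≤ liminf (fun k => fiberSum E w n P (v k) x) atTop := by
  classical
  let _ : MeasurableSpace X := ⊤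
  have h := MeasureTheory.lintegral_liminf_le (μ := MeasureTheory.Measure.count)
    (u := atTop)
    (f := fun k y => if E^[n] y = x ∧ P y then cocycle E w n y * v k y else 0)
    (fun k => fun _ _ => trivial)
  simp only [MeasureTheory.lintegral_count] at h
  refine le_trans (ENNReal.tsum_le_tsum fun y => ?_) h
  split_ifs
  · exact ENNReal.le_liminf_mul.trans' (by simp)
  · exact zero_le

/-- The term of `y₀` is absent from the cone sum but present in the full transfer sum. -/
theorem coneSum_add_le_fiberSum {w : X → ℝ≥0∞} {N : ℕ} {x y₀ : X} {σ : ℝ}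
    (hy₀ : E^[N] y₀ = x) (hy₁ : θ < |pull E d b N y₀ σ|) (u : X → ℝ≥0∞) :
    coneSum E w d b θ N u x σ + cocycle E w N y₀ * u y₀
      ≤ fiberSum E w N (fun _ => True) u x := by
  classical
  calc _ = coneSum E w d b θ N u x σ + ∑' y, (if y = y₀ then cocycle E w N y * u y else 0) := by
        rw [tsum_ite_eq]
    _ ≤ _ := by
        rw [coneSum, fiberSum, fiberSum, ← ENNReal.tsum_add]
        refine ENNReal.tsum_le_tsum fun y => ?_
        by_cases h : y = y₀
        · subst h
          simp [hy₀, hy₁.not_ge]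
        · simp only [h, if_false, add_zero, and_true]
          split_ifs with h2 h3 h3
          · exact le_rfl
          · exact absurd h2.1 h3
          · exact zero_le
          · exact le_rfl

/-- A block that omits a point of each fibre contracts the weighted cone sums, provided the
transfer operator has bounded iterates. -/
theorem exists_coneSum_contraction {w : X → ℝ≥0∞} {C κ : ℝ≥0∞} (hC : C ≠ ∞) (hC0 : C ≠ 0)
    (hκ0 : κ ≠ 0) (hκ : ∀ y, κ ≤ w y)
    (hup : ∀ n x, fiberSum E w n (fun _ => True) 1 x ≤ C)
    (hlo : ∀ n x, C⁻¹ ≤ fiberSum E w n (fun _ => True) 1 x) {N : ℕ}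
    (hN : ∀ x σ, ∃ y, E^[N] y = x ∧ θ < |pull E d b N y σ|) :
    ∃ u : X → ℝ≥0∞, (∀ x, u x ≤ C) ∧ (∀ x, C⁻¹ ≤ u x) ∧ ∃ q < 1, ∀ x σ,
      coneSum E w d b θ N u x σ ≤ u x * q := by
  classical
  -- A substitute for the invariant density: by Fatou the liminf of the iterates of `1` is a
  -- supersolution, which suffices and needs no convergence.
  let u : X → ℝ≥0∞ := fun x => liminf (fun k => fiberSum E w k (fun _ => True) 1 x) atTop
  have hu1 : ∀ x, u x ≤ C := fun x =>
    liminf_le_of_frequently_le' (Frequently.of_forall fun k => hup k x)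
  have hu2 : ∀ x, C⁻¹ ≤ u x := fun x => le_liminf_of_le (by isBoundedDefault)
    (Eventually.of_forall fun k => hlo k x)
  have hLu : ∀ x, fiberSum E w N (fun _ => True) u x ≤ u x := fun x => by
    refine (fiberSum_liminf_le w N _ _ x).trans ?_
    simp_rw [← fiberSum_true_add]
    have : (fun k => fiberSum E w (N + k) (fun _ => True) 1 x)
        = fun k => (fun k => fiberSum E w k (fun _ => True) 1 x) (k + N) := by
      ext k; rw [add_comm]
    rw [this, Filter.liminf_nat_add (fun k => fiberSum E w k (fun _ => True) 1 x) N]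
  have hκN : ∀ n y, κ ^ n ≤ cocycle E w n y := by
    intro n
    induction n with
    | zero => simp [cocycle]
    | succ n ih =>
      intro y
      rw [cocycle, pow_succ']
      exact mul_le_mul' (hκ y) (ih _)
  -- The omitted term is at least `κ ^ N * C⁻¹`; the further factor `C⁻¹` expresses it as a fraction
  -- of `u x ≤ C`.
  set ε := κ ^ N * C⁻¹ * C⁻¹ with hε
  have hε0 : ε ≠ 0 := by
    simp [hε, hC, hκ0]
  refine ⟨u, hu1, hu2, 1 - ε, ENNReal.sub_lt_self (by simp) (by simp) hε0, fun x σ => ?_⟩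
  obtain ⟨y₀, hy₀, hy₁⟩ := hN x σ
  have hutop : u x ≠ ∞ := ((hu1 x).trans_lt hC.lt_top).ne
  rw [ENNReal.mul_sub (fun _ _ => hutop), mul_one]
  refine ENNReal.le_sub_of_add_le_right ?_ ?_
  · refine ENNReal.mul_ne_top hutop ?_
    have h1 : κ ^ N * C⁻¹ ≤ C := by
      calc κ ^ N * C⁻¹ ≤ cocycle E w N y₀ * u y₀ := mul_le_mul' (hκN N y₀) (hu2 y₀)
        _ ≤ fiberSum E w N (fun _ => True) u x := by
          refine le_trans ?_ (ENNReal.le_tsum y₀)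
          simp [hy₀]
        _ ≤ C := (hLu x).trans (hu1 x)
    exact ENNReal.mul_ne_top (h1.trans_lt hC.lt_top).ne (by simpa using hC0)
  · refine le_trans ?_ (hLu x)
    have h1 : u x * ε ≤ cocycle E w N y₀ * u y₀ := by
      calc u x * ε ≤ C * (κ ^ N * C⁻¹ * C⁻¹) := by gcongr; exact hu1 x
        _ = κ ^ N * C⁻¹ * (C * C⁻¹) := by ring
        _ = κ ^ N * C⁻¹ := by rw [ENNReal.mul_inv_cancel hC0 hC, mul_one]
        _ ≤ _ := mul_le_mul' (hκN N y₀) (hu2 y₀)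
    exact (add_le_add_right h1 _).trans (coneSum_add_le_fiberSum hy₀ hy₁ u)

end Cocycles

/-! ### Lifts, inverse branches and bounded distortion -/

section Lifts

/-- The function on the circle induced by a `1`-periodic function on the line. -/
noncomputable def onCircle (h : ℝ → ℝ) (y : UnitAddCircle) : ℝ := h (centeredRep y)

theorem coe_centeredRep (y : UnitAddCircle) : (centeredRep y : UnitAddCircle) = y :=
  (AddCircle.equivIco (1 : ℝ) (-1 / 2)).symm_apply_apply y

theorem exists_int_of_coe_eq {s t : ℝ} (h : (s : UnitAddCircle) = t) : ∃ k : ℤ, s = t + k := by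
  have h0 : ((s - t : ℝ) : UnitAddCircle) = 0 := by rw [AddCircle.coe_sub, h, sub_self]
  obtain ⟨k, hk⟩ := (AddCircle.coe_eq_zero_iff 1).1 h0
  refine ⟨k, ?_⟩
  simp only [zsmul_eq_mul, mul_one] at hk
  linarith

theorem onCircle_coe {h : ℝ → ℝ} (hh : Function.Periodic h 1) (t : ℝ) :
    onCircle h (t : UnitAddCircle) = h t := by
  obtain ⟨k, hk⟩ := exists_int_of_coe_eq (coe_centeredRep (t : UnitAddCircle))
  rw [onCircle, hk]
  simpa using hh.int_mul k t

theorem continuous_onCircle {h : ℝ → ℝ} (hh : Function.Periodic h 1) (hc : Continuous h) :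
    Continuous (onCircle h) :=
  continuous_coinduced_dom.2 (by
    convert hc using 1
    ext t
    exact onCircle_coe hh t)

theorem exists_abs_le_of_periodic {h : ℝ → ℝ} {c : ℝ} (hc : c ≠ 0)
    (hh : Function.Periodic h c) (hcont : Continuous h) : ∃ C, 0 < C ∧ ∀ t, |h t| ≤ C := by
  obtain ⟨C, hC⟩ := (hh.isBounded_of_continuous hc hcont).exists_norm_le
  exact ⟨max C 1, by positivity, fun t => (hC _ ⟨t, rfl⟩).trans (le_max_left _ _)⟩

theorem periodic_deriv {h : ℝ → ℝ} {c a : ℝ} (hh : ∀ t, h (t + c) = h t + a) :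
    Function.Periodic (deriv h) c := fun t => by
  rw [← deriv_comp_add_const]
  simp_rw [hh]
  rw [deriv_add_const]

/-- `F` is a lift of the expanding circle map `E`, and `G` is the inverse of `F`. -/
structure LiftPair (r : ℕ∞) (ℓ : ℕ) (lam : ℝ) (E : UnitAddCircle → UnitAddCircle)
    (F G : ℝ → ℝ) : Prop where
  contDiff : ContDiff ℝ r F
  map_add_one : ∀ t, F (t + 1) = F t + ℓ
  coe : ∀ t : ℝ, E (t : UnitAddCircle) = (F t : UnitAddCircle)
  le_deriv : ∀ t, lam ≤ deriv F t
  contDiff_inv : ContDiff ℝ r G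
  right_inv : ∀ t, F (G t) = t
  left_inv : ∀ t, G (F t) = t

theorem IsExpandingMap.exists_liftPair {r : ℕ∞} (hr : 2 ≤ r) {ℓ : ℕ} {lam : ℝ} (hlam : 1 < lam)
    {E : UnitAddCircle → UnitAddCircle} (hE : IsExpandingMap r ℓ lam E) :
    ∃ F G, LiftPair r ℓ lam E F G := by
  obtain ⟨F, hF, h1, h2, h3⟩ := hE
  have hr1 : (r : WithTop ℕ∞) ≠ 0 := by
    have : r ≠ 0 := by rintro rfl; simp at hr
    exact_mod_cast this
  have hdiff : Differentiable ℝ F := hF.differentiable hr1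
  have hmono : StrictMono F := strictMono_of_deriv_pos fun t => by linarith [h3 t]
  have hgrow : ∀ s t, s ≤ t → lam * (t - s) ≤ F t - F s := fun s t hst =>
    mul_sub_le_image_sub_of_le_deriv hdiff h3 hst
  have hsurj : Function.Surjective F := by
    apply hdiff.continuous.surjective
    · refine tendsto_atTop_mono' _ ?_ (tendsto_atTop_add_const_left _ (F 0) tendsto_id)
      filter_upwards [eventually_ge_atTop 0] with t ht
      have := hgrow 0 t ht
      simp only [id]
      nlinarith
    · refine tendsto_atBot_mono' _ ?_ (tendsto_atBot_add_const_left _ (F 0) tendsto_id)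
      filter_upwards [eventually_le_atBot 0] with t ht
      have := hgrow t 0 ht
      simp only [id]
      nlinarith
  let H : ℝ ≃ₜ ℝ := (hmono.orderIsoOfSurjective F hsurj).toHomeomorph
  have hH : ∀ t, H t = F t := fun t => rfl
  refine ⟨F, H.symm, hF, h1, h2, h3, ?_, fun t => H.apply_symm_apply t,
    fun t => H.symm_apply_apply t⟩
  exact H.contDiff_symm_deriv (f' := deriv F) (fun t => by linarith [h3 t])
    (fun t => (hdiff t).hasDerivAt) hF

namespace LiftPair

variable {r : ℕ∞} {ℓ : ℕ} {lam : ℝ} {E : UnitAddCircle → UnitAddCircle} {F G : ℝ → ℝ}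

theorem two_le (hr : 2 ≤ r) : (2 : WithTop ℕ∞) ≤ r := by
  have : ((2 : ℕ∞) : WithTop ℕ∞) ≤ r := WithTop.coe_le_coe.2 hr
  simpa using this

theorem one_le (hr : 2 ≤ r) : (1 : WithTop ℕ∞) ≤ r := le_trans (by norm_num) (two_le hr)

theorem ne_zero (hr : 2 ≤ r) : (r : WithTop ℕ∞) ≠ 0 := fun h => by
  have := one_le hr
  simp [h] at this

theorem periodic (h : LiftPair r ℓ lam E F G) : Function.Periodic (deriv F) 1 :=
  periodic_deriv h.map_add_one

theorem continuous_deriv (h : LiftPair r ℓ lam E F G) (hr : 2 ≤ r) : Continuous (deriv F) :=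
  h.contDiff.continuous_deriv (one_le hr)

theorem differentiable (h : LiftPair r ℓ lam E F G) (hr : 2 ≤ r) : Differentiable ℝ F :=
  h.contDiff.differentiable (ne_zero hr)

theorem le_onCircle (h : LiftPair r ℓ lam E F G) (y : UnitAddCircle) :
    lam ≤ onCircle (deriv F) y := h.le_deriv _

theorem continuous_map (h : LiftPair r ℓ lam E F G) : Continuous E :=
  continuous_coinduced_dom.2 (by
    have : E ∘ (fun t : ℝ => (t : UnitAddCircle)) = fun t => ((F t : ℝ) : UnitAddCircle) := by
      ext t; exact h.coe t
    exact this ▸ (AddCircle.continuous_mk' (1 : ℝ)).comp h.contDiff.continuous)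

theorem iterate_coe (h : LiftPair r ℓ lam E F G) (n : ℕ) (t : ℝ) :
    E^[n] (t : UnitAddCircle) = ((F^[n] t : ℝ) : UnitAddCircle) := by
  induction n with
  | zero => rfl
  | succ n ih => rw [Function.iterate_succ_apply', ih, h.coe, Function.iterate_succ_apply']

theorem iterate_right_inv (h : LiftPair r ℓ lam E F G) (n : ℕ) (t : ℝ) :
    F^[n] (G^[n] t) = t :=
  (Function.LeftInverse.iterate (g := F) (f := G) h.right_inv n) t

theorem iterate_left_inv (h : LiftPair r ℓ lam E F G) (n : ℕ) (t : ℝ) :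
    G^[n] (F^[n] t) = t :=
  (Function.LeftInverse.iterate (g := G) (f := F) h.left_inv n) t

theorem map_inv (h : LiftPair r ℓ lam E F G) (t : ℝ) :
    E (G t : UnitAddCircle) = (t : UnitAddCircle) := by rw [h.coe, h.right_inv]

theorem iterate_map_inv (h : LiftPair r ℓ lam E F G) (n : ℕ) (t : ℝ) :
    E^[n] (G^[n] t : UnitAddCircle) = (t : UnitAddCircle) := by
  rw [h.iterate_coe, h.iterate_right_inv]

theorem inv_add_degree (h : LiftPair r ℓ lam E F G) (t : ℝ) : G (t + ℓ) = G t + 1 := by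
  rw [← h.left_inv (G t + 1), h.map_add_one, h.right_inv]

theorem inv_add_mul (h : LiftPair r ℓ lam E F G) (q : ℤ) (t : ℝ) : G (t + q * ℓ) = G t + q := by
  induction q using Int.induction_on with
  | zero => simp
  | succ i ih =>
    push_cast at ih ⊢
    rw [add_mul, ← add_assoc, one_mul, h.inv_add_degree, ih]
    ring
  | pred i ih =>
    have := h.inv_add_degree (t + (-(i : ℝ) - 1) * ℓ)
    push_cast at ih ⊢
    rw [show t + (-(i : ℝ) - 1) * ℓ + ℓ = t + -(i : ℝ) * ℓ by ring, ih] at this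
    linarith

theorem iterate_inv_add_mul (h : LiftPair r ℓ lam E F G) (n : ℕ) (q : ℤ) (t : ℝ) :
    G^[n] (t + q * (ℓ : ℝ) ^ n) = G^[n] t + q := by
  induction n generalizing t with
  | zero => simp
  | succ n ih =>
    have := h.inv_add_mul (q * (ℓ : ℤ) ^ n) t
    push_cast at this
    rw [Function.iterate_succ_apply, Function.iterate_succ_apply, ← ih, pow_succ, ← mul_assoc,
      this]

theorem hasDerivAt_inv (h : LiftPair r ℓ lam E F G) (hr : 2 ≤ r) (hlam : 1 < lam) (t : ℝ) :
    HasDerivAt G (1 / deriv F (G t)) t := by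
  rw [one_div]
  exact HasDerivAt.of_local_left_inverse h.contDiff_inv.continuous.continuousAt
    (h.differentiable hr _).hasDerivAt (by linarith [h.le_deriv (G t)])
    (Eventually.of_forall h.right_inv)

theorem hasDerivAt_iterate_inv (h : LiftPair r ℓ lam E F G) (hr : 2 ≤ r) (hlam : 1 < lam)
    (n : ℕ) (t : ℝ) :
    HasDerivAt (G^[n]) (1 / cocycle E (onCircle (deriv F)) n (G^[n] t : UnitAddCircle)) t := by
  induction n with
  | zero => simpa [cocycle] using hasDerivAt_id t
  | succ n ih =>
    have := (h.hasDerivAt_inv hr hlam (G^[n] t)).comp t ih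
    rw [Function.iterate_succ']
    refine this.congr_deriv ?_
    simp only [cocycle, Function.comp_apply]
    rw [onCircle_coe h.periodic, h.map_inv, one_div_mul_one_div]

theorem abs_iterate_inv_sub_le (h : LiftPair r ℓ lam E F G) (hr : 2 ≤ r) (hlam : 1 < lam)
    (n : ℕ) (s t : ℝ) : |G^[n] s - G^[n] t| ≤ |s - t| / lam ^ n := by
  have := Convex.norm_image_sub_le_of_norm_hasDerivWithin_le (f := G^[n]) (s := Set.univ)
    (C := 1 / lam ^ n) (fun x _ => (h.hasDerivAt_iterate_inv hr hlam n x).hasDerivWithinAt)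
    (fun x _ => by
      have h1 := pow_le_cocycle (E := E) (by linarith) h.le_onCircle n (G^[n] x : UnitAddCircle)
      have h0 : 0 < lam ^ n := by positivity
      rw [Real.norm_eq_abs, abs_of_pos (one_div_pos.2 (h0.trans_le h1))]
      exact one_div_le_one_div_of_le h0 h1) convex_univ (Set.mem_univ t) (Set.mem_univ s)
  simp only [Real.norm_eq_abs] at this
  rwa [one_div_mul_eq_div] at this

/-- The fibre of `E^[n]` over `x` consists of the `ℓ ^ n` points `G^[n] (x + k)`. -/
theorem iterate_eq_iff (h : LiftPair r ℓ lam E F G) (hℓ : 2 ≤ ℓ) (n : ℕ) (x : ℝ)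
    (y : UnitAddCircle) :
    E^[n] y = (x : UnitAddCircle) ↔
      ∃ k ∈ Finset.range (ℓ ^ n), ((G^[n] (x + k) : ℝ) : UnitAddCircle) = y := by
  constructor
  · intro hy
    rw [← coe_centeredRep y, h.iterate_coe] at hy
    obtain ⟨j, hj⟩ := exists_int_of_coe_eq hy
    have hpos : (0 : ℤ) < (ℓ : ℤ) ^ n := by positivity
    have h0 := Int.emod_nonneg j hpos.ne'
    -- Shifting the argument of `G^[n]` by a multiple of `ℓ ^ n` shifts its value by an integer, so
    -- only the residue matters.
    refine ⟨(j % (ℓ : ℤ) ^ n).toNat, ?_, ?_⟩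
    · rw [Finset.mem_range]
      have := Int.emod_lt_of_pos j hpos
      zify
      rwa [Int.toNat_of_nonneg h0]
    · have e : (((j % (ℓ : ℤ) ^ n).toNat : ℕ) : ℝ) = ((j % (ℓ : ℤ) ^ n : ℤ) : ℝ) := by
        exact_mod_cast congrArg (Int.cast (R := ℝ)) (Int.toNat_of_nonneg h0)
      have h1 := h.iterate_inv_add_mul n (j / (ℓ : ℤ) ^ n) (x + ((j % (ℓ : ℤ) ^ n : ℤ) : ℝ))
      have h2 : x + ((j % (ℓ : ℤ) ^ n : ℤ) : ℝ) + ((j / (ℓ : ℤ) ^ n : ℤ) : ℝ) * (ℓ : ℝ) ^ n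
          = x + j := by
        rw [add_assoc]
        congr 1
        have := Int.emod_add_ediv_mul j ((ℓ : ℤ) ^ n)
        exact_mod_cast this
      rw [h2, ← hj, h.iterate_left_inv] at h1
      rw [e]
      conv_rhs => rw [← coe_centeredRep y, h1]
      simp
  · rintro ⟨k, -, rfl⟩
    rw [h.iterate_map_inv]
    simpa using (AddCircle.coe_eq_zero_iff (1 : ℝ)).2 ⟨k, by simp⟩

theorem injOn_fiber (h : LiftPair r ℓ lam E F G) (n : ℕ) (x : ℝ) :
    Set.InjOn (fun k : ℕ => ((G^[n] (x + k) : ℝ) : UnitAddCircle))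
      (Finset.range (ℓ ^ n)) := by
  intro k hk k' hk' hkk
  obtain ⟨q, hq⟩ := exists_int_of_coe_eq hkk
  rw [← h.iterate_inv_add_mul] at hq
  have h1 := congrArg (F^[n]) hq
  rw [h.iterate_right_inv, h.iterate_right_inv] at h1
  have h2 : (k : ℤ) = k' + q * (ℓ : ℤ) ^ n := by
    have : (k : ℝ) = k' + q * (ℓ : ℝ) ^ n := by linarith
    exact_mod_cast this
  simp only [Finset.coe_range, Set.mem_Iio] at hk hk'
  have h3 := congrArg (· % (ℓ : ℤ) ^ n) h2
  simp only [Int.add_mul_emod_self_right] at h3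
  rw [Int.emod_eq_of_lt (by positivity) (by exact_mod_cast hk),
    Int.emod_eq_of_lt (by positivity) (by exact_mod_cast hk')] at h3
  exact_mod_cast h3

open Classical in
theorem tsum_fiber (h : LiftPair r ℓ lam E F G) (hℓ : 2 ≤ ℓ) (n : ℕ) (x : ℝ)
    (g : UnitAddCircle → ℝ≥0∞) :
    ∑' y, (if E^[n] y = (x : UnitAddCircle) then g y else 0)
      = ∑ k ∈ Finset.range (ℓ ^ n), g (G^[n] (x + k) : ℝ) := by
  rw [tsum_eq_sum (s := (Finset.range (ℓ ^ n)).image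
    fun k : ℕ => ((G^[n] (x + k) : ℝ) : UnitAddCircle))]
  · rw [Finset.sum_image (h.injOn_fiber n x)]
    refine Finset.sum_congr rfl fun k hk => if_pos ?_
    exact (h.iterate_eq_iff hℓ n x _).2 ⟨k, hk, rfl⟩
  · intro y hy
    rw [if_neg]
    rw [h.iterate_eq_iff hℓ]
    simpa using hy

/-- Bounded distortion of the inverse branches. -/
theorem exists_distortion (h : LiftPair r ℓ lam E F G) (hr : 2 ≤ r) (hlam : 1 < lam) :
    ∃ K : ℝ, 0 < K ∧ ∀ (n : ℕ) (s t : ℝ), |s - t| ≤ 1 →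
      cocycle E (onCircle (deriv F)) n (G^[n] s : UnitAddCircle)
        ≤ K * cocycle E (onCircle (deriv F)) n (G^[n] t : UnitAddCircle) := by
  have hF2 : ContDiff ℝ 1 (deriv F) :=
    ((contDiff_succ_iff_deriv (n := 1)).1 (h.contDiff.of_le (two_le hr))).2.2
  obtain ⟨c, hc0, hc⟩ := exists_abs_le_of_periodic one_ne_zero
    (periodic_deriv (h := deriv F) (a := 0) (fun t => by simpa using h.periodic t))
    (hF2.continuous_deriv le_rfl)
  have hLip : ∀ s t, |deriv F s - deriv F t| ≤ c * |s - t| := fun s t =>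
    Convex.norm_image_sub_le_of_norm_deriv_le (s := Set.univ)
      (fun x _ => hF2.differentiable one_ne_zero x) (fun x _ => hc x) convex_univ
      (Set.mem_univ t) (Set.mem_univ s)
  have hrat : ∀ s t, deriv F s ≤ Real.exp (c * |s - t|) * deriv F t := fun s t => by
    have h1 := (abs_le.1 (hLip s t)).2
    have h2 := Real.add_one_le_exp (c * |s - t|)
    have h3 := h.le_deriv t
    have h4 : 0 ≤ c * |s - t| := by positivity
    nlinarith
  have hl0 : 0 < lam - 1 := by linarith
  -- Level `j` contributes `c / lam ^ j` to the exponent, and `(1 - 1 / lam ^ n) / (lam - 1)` is the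
  -- sum of `1 / lam ^ j` over `1 ≤ j ≤ n`.
  have key : ∀ (n : ℕ) (s t : ℝ), |s - t| ≤ 1 →
      cocycle E (onCircle (deriv F)) n (G^[n] s : UnitAddCircle)
        ≤ Real.exp (c * ((1 - 1 / lam ^ n) / (lam - 1)))
          * cocycle E (onCircle (deriv F)) n (G^[n] t : UnitAddCircle) := by
    intro n s t hst
    induction n with
    | zero => simp [cocycle]
    | succ n ih =>
      rw [cocycle, cocycle, Function.iterate_succ_apply', Function.iterate_succ_apply',
        onCircle_coe h.periodic, onCircle_coe h.periodic, h.map_inv, h.map_inv]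
      have h1 : |G (G^[n] s) - G (G^[n] t)| ≤ 1 / lam ^ (n + 1) := by
        rw [← Function.iterate_succ_apply' G, ← Function.iterate_succ_apply' G]
        refine (h.abs_iterate_inv_sub_le hr hlam _ s t).trans ?_
        gcongr
      have h2 : deriv F (G (G^[n] s))
          ≤ Real.exp (c * (1 / lam ^ (n + 1))) * deriv F (G (G^[n] t)) := by
        refine (hrat _ (G (G^[n] t))).trans ?_
        have := h.le_deriv (G (G^[n] t))
        gcongr
        linarith
      have e : c * ((1 - 1 / lam ^ (n + 1)) / (lam - 1))
          = c * (1 / lam ^ (n + 1)) + c * ((1 - 1 / lam ^ n) / (lam - 1)) := by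
        field_simp
        ring
      rw [e, Real.exp_add, mul_mul_mul_comm]
      refine mul_le_mul h2 ih (cocycle_pos (by linarith) h.le_onCircle _ _).le ?_
      have := h.le_deriv (G (G^[n] t))
      exact mul_nonneg (Real.exp_pos _).le (by linarith)
  refine ⟨Real.exp (c * (1 / (lam - 1))), Real.exp_pos _, fun n s t hst => ?_⟩
  refine (key n s t hst).trans ?_
  have h1 := cocycle_pos (E := E) (by linarith) h.le_onCircle n (G^[n] t : UnitAddCircle)
  gcongr
  have : 0 < 1 / lam ^ n := by positivity
  linarith

/-- The iterates of the transfer operator with weight `1 / E'` applied to the constant `1` are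
bounded from above and from below. -/
theorem exists_transfer_bounds (h : LiftPair r ℓ lam E F G) (hr : 2 ≤ r) (hlam : 1 < lam)
    (hℓ : 2 ≤ ℓ) :
    ∃ C : ℝ≥0∞, C ≠ ∞ ∧ C ≠ 0 ∧
      (∀ n x, fiberSum E (fun y => ENNReal.ofReal (1 / onCircle (deriv F) y)) n
        (fun _ => True) 1 x ≤ C) ∧
      (∀ n x, C⁻¹ ≤ fiberSum E (fun y => ENNReal.ofReal (1 / onCircle (deriv F) y)) n
        (fun _ => True) 1 x) := by
  classical
  obtain ⟨K, hK0, hK⟩ := h.exists_distortion hr hlam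
  have hdpos : ∀ y, 0 < onCircle (deriv F) y := fun y => by linarith [h.le_onCircle y]
  set D := cocycle E (onCircle (deriv F)) with hD
  have hDpos : ∀ n y, 0 < D n y := fun n y => cocycle_pos (by linarith) h.le_onCircle n y
  have hrepr : ∀ n (x : ℝ), fiberSum E (fun y => ENNReal.ofReal (1 / onCircle (deriv F) y)) n
        (fun _ => True) 1 x = ENNReal.ofReal (∑ k ∈ Finset.range (ℓ ^ n),
          1 / D n (G^[n] (x + k) : ℝ)) := by
    intro n x
    rw [ENNReal.ofReal_sum_of_nonneg (fun k _ => (one_div_pos.2 (hDpos _ _)).le), fiberSum]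
    simp only [and_true, Pi.one_apply, mul_one, ← ofReal_one_div_cocycle hdpos]
    rw [h.tsum_fiber hℓ]
  -- By the mean value theorem each weight is comparable, up to distortion, with the length of a
  -- branch interval; these intervals tile an interval of length `1`.
  have hinc : ∀ n (t : ℝ), ∃ ξ, |ξ - t| ≤ 1 ∧
      G^[n] (t + 1) - G^[n] t = 1 / D n (G^[n] ξ : ℝ) := by
    intro n t
    obtain ⟨ξ, h1, h2⟩ := exists_hasDerivAt_eq_slope (G^[n]) _ (lt_add_one t)
      (h.contDiff_inv.continuous.iterate n).continuousOn
      (fun x _ => h.hasDerivAt_iterate_inv hr hlam n x)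
    refine ⟨ξ, abs_le.2 ⟨by linarith [h1.1], by linarith [h1.2]⟩, ?_⟩
    rw [← hD] at h2
    rw [h2]
    simp
  have htel : ∀ n (x : ℝ), ∑ k ∈ Finset.range (ℓ ^ n),
      (G^[n] (x + k + 1) - G^[n] (x + k)) = 1 := by
    intro n x
    have h1 := Finset.sum_range_sub (fun k : ℕ => G^[n] (x + k)) (ℓ ^ n)
    have h2 := h.iterate_inv_add_mul n 1 x
    simp only [Int.cast_one, one_mul] at h2
    push_cast at h1
    simp only [add_assoc] at h1 ⊢
    rw [h1, h2]
    simp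
  have hup : ∀ n (x : ℝ), ∑ k ∈ Finset.range (ℓ ^ n), 1 / D n (G^[n] (x + k) : ℝ) ≤ K := by
    intro n x
    refine le_trans (b := K * ∑ k ∈ Finset.range (ℓ ^ n),
      (G^[n] (x + k + 1) - G^[n] (x + k))) ?_ (by rw [htel, mul_one])
    rw [Finset.mul_sum]
    refine Finset.sum_le_sum fun k _ => ?_
    obtain ⟨ξ, h1, h2⟩ := hinc n (x + k)
    rw [h2, mul_one_div, div_le_div_iff₀ (hDpos _ _) (hDpos _ _), one_mul]
    exact hK n _ _ h1
  have hlo : ∀ n (x : ℝ), K⁻¹ ≤ ∑ k ∈ Finset.range (ℓ ^ n), 1 / D n (G^[n] (x + k) : ℝ) := by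
    intro n x
    rw [inv_le_iff_one_le_mul₀' hK0]
    refine (htel n x).symm.le.trans ?_
    rw [Finset.mul_sum]
    refine Finset.sum_le_sum fun k _ => ?_
    obtain ⟨ξ, h1, h2⟩ := hinc n (x + k)
    rw [h2, mul_one_div, div_le_div_iff₀ (hDpos _ _) (hDpos _ _), one_mul]
    exact hK n _ _ (by rwa [abs_sub_comm])
  refine ⟨ENNReal.ofReal K, ENNReal.ofReal_ne_top, by simpa using hK0, fun n x => ?_,
    fun n x => ?_⟩
  · rw [← coe_centeredRep x, hrepr]
    exact ENNReal.ofReal_le_ofReal (hup _ _)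
  · rw [← coe_centeredRep x, hrepr, ← ENNReal.ofReal_inv_of_pos hK0]
    exact ENNReal.ofReal_le_ofReal (hlo _ _)

end LiftPair

end Lifts

/-! ### Reduction of the skew product to its base -/

section SkewProducts

/-- The linear map `(ξ, η) ↦ (D ξ, η + B ξ)`. -/
noncomputable def shear (D B : ℝ) : (ℝ × ℝ) →L[ℝ] (ℝ × ℝ) :=
  (D • ContinuousLinearMap.fst ℝ ℝ ℝ).prod
    (ContinuousLinearMap.snd ℝ ℝ ℝ + B • ContinuousLinearMap.fst ℝ ℝ ℝ)

theorem shear_apply (D B : ℝ) (v : ℝ × ℝ) : shear D B v = (D * v.1, v.2 + B * v.1) := by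
  simp [shear]

theorem det_shear (D B : ℝ) : (shear D B).det = D := by
  rw [ContinuousLinearMap.det, ← LinearMap.det_toMatrix (Module.Basis.finTwoProd ℝ),
    Matrix.det_fin_two]
  simp [LinearMap.toMatrix_apply, shear_apply]

theorem shear_comp_shear (D B D' B' : ℝ) :
    (shear D B).comp (shear D' B') = shear (D * D') (B' + B * D') := by
  apply ContinuousLinearMap.ext
  intro v
  simp only [ContinuousLinearMap.comp_apply, shear_apply, Prod.mk.injEq]
  constructor <;> ring

variable {r : ℕ∞} {ℓ : ℕ} {lam : ℝ} {E : UnitAddCircle → UnitAddCircle} {F G : ℝ → ℝ}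
  {τ : UnitAddCircle → ℝ}

/-- The derivative of a function on the circle. -/
noncomputable def circleDeriv (φ : UnitAddCircle → ℝ) : UnitAddCircle → ℝ :=
  onCircle (deriv fun t : ℝ => φ (t : UnitAddCircle))

theorem circleDeriv_coe (φ : UnitAddCircle → ℝ) (t : ℝ) :
    circleDeriv φ (t : UnitAddCircle) = deriv (fun t : ℝ => φ (t : UnitAddCircle)) t :=
  onCircle_coe (periodic_deriv (a := 0) fun t => by simp) t

theorem IsCr.differentiable (hr : 2 ≤ r) {φ : UnitAddCircle → ℝ} (hφ : IsCr r φ) :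
    Differentiable ℝ fun t : ℝ => φ (t : UnitAddCircle) :=
  ContDiff.differentiable hφ (LiftPair.ne_zero hr)

theorem IsCr.continuous_deriv (hr : 2 ≤ r) {φ : UnitAddCircle → ℝ} (hφ : IsCr r φ) :
    Continuous (deriv fun t : ℝ => φ (t : UnitAddCircle)) :=
  ContDiff.continuous_deriv hφ (LiftPair.one_le hr)

theorem IsCr.continuous_circleDeriv (hr : 2 ≤ r) {φ : UnitAddCircle → ℝ} (hφ : IsCr r φ) :
    Continuous (circleDeriv φ) :=
  continuous_onCircle (periodic_deriv (a := 0) fun t => by simp) (hφ.continuous_deriv hr)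

theorem IsCr.abs_circleDeriv_le (hr : 2 ≤ r) (hτ : IsCr r τ) (y : UnitAddCircle) :
    |circleDeriv τ y| ≤ derivSupNorm τ := by
  obtain ⟨C, -, hC⟩ := exists_abs_le_of_periodic one_ne_zero
    (periodic_deriv (h := fun t : ℝ => τ (t : UnitAddCircle)) (a := 0) fun t => by simp)
    (hτ.continuous_deriv hr)
  exact le_ciSup (f := fun t : ℝ => |deriv (fun s : ℝ => τ (s : UnitAddCircle)) t|)
    ⟨C, by rintro _ ⟨t, rfl⟩; exact hC t⟩ _

/-- A lift of the skew product to the plane. -/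
noncomputable def skewLift (F : ℝ → ℝ) (τ : UnitAddCircle → ℝ) (u : ℝ × ℝ) : ℝ × ℝ :=
  (F u.1, u.2 + τ (u.1 : UnitAddCircle))

theorem LiftPair.skewProduct_toTorus (h : LiftPair r ℓ lam E F G) (n : ℕ) (u : ℝ × ℝ) :
    (skewProduct E τ)^[n] (toTorus u) = toTorus ((skewLift F τ)^[n] u) := by
  induction n generalizing u with
  | zero => rfl
  | succ n ih =>
    rw [Function.iterate_succ_apply, Function.iterate_succ_apply, ← ih]
    congr 1
    simp [skewProduct, toTorus, skewLift, h.coe]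

theorem LiftPair.hasFDerivAt_skewLift (h : LiftPair r ℓ lam E F G) (hr : 2 ≤ r)
    (hτ : IsCr r τ) (n : ℕ) (u : ℝ × ℝ) :
    HasFDerivAt ((skewLift F τ)^[n])
      (shear (cocycle E (onCircle (deriv F)) n (u.1 : UnitAddCircle))
        (-pull E (onCircle (deriv F)) (circleDeriv τ) n (u.1 : UnitAddCircle) 0)) u := by
  induction n generalizing u with
  | zero =>
    have : shear 1 0 = ContinuousLinearMap.id ℝ (ℝ × ℝ) := by
      apply ContinuousLinearMap.ext
      intro v
      simp [shear_apply]
    simpa [cocycle, pull, this] using hasFDerivAt_id (𝕜 := ℝ) u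
  | succ n ih =>
    have h1 : HasFDerivAt (skewLift F τ) (shear (deriv F u.1)
        (deriv (fun t : ℝ => τ (t : UnitAddCircle)) u.1)) u := by
      have hF := (h.differentiable hr u.1).hasDerivAt.comp_hasFDerivAt u
        (hasFDerivAt_fst (𝕜 := ℝ) (p := u))
      have hT := (hτ.differentiable hr u.1).hasDerivAt.comp_hasFDerivAt u
        (hasFDerivAt_fst (𝕜 := ℝ) (p := u))
      exact hF.prodMk ((hasFDerivAt_snd (𝕜 := ℝ) (p := u)).add hT)
    have h2 := (ih (skewLift F τ u)).comp u h1
    rw [Function.iterate_succ]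
    refine h2.congr_fderiv ?_
    rw [shear_comp_shear]
    have e : E (u.1 : UnitAddCircle) = ((skewLift F τ u).1 : UnitAddCircle) := h.coe _
    simp only [cocycle, pull]
    rw [onCircle_coe h.periodic, circleDeriv_coe, e]
    congr 1 <;> ring

theorem exists_toTorus_eq (ζ : Torus) : ∃ u, toTorus u = ζ :=
  ⟨(centeredRep ζ.1, centeredRep ζ.2), by simp [toTorus, coe_centeredRep]⟩

theorem LiftPair.torusDeriv_skewProduct (h : LiftPair r ℓ lam E F G) (hr : 2 ≤ r)
    (hτ : IsCr r τ) (n : ℕ) (ζ : Torus) :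
    torusDeriv ((skewProduct E τ)^[n]) ζ = shear (cocycle E (onCircle (deriv F)) n ζ.1)
        (-pull E (onCircle (deriv F)) (circleDeriv τ) n ζ.1 0) := by
  obtain ⟨u, rfl⟩ := exists_toTorus_eq ζ
  have h1 := h.hasFDerivAt_skewLift hr hτ n u
  rw [torusDeriv_eq_fderiv_lift (h.skewProduct_toTorus n) h1.continuousAt, h1.fderiv]
  rfl

/-- The cone inequality for the inverse shear of `v`, with the denominator `D > 0` cleared; in this
form it also covers vertical vectors. -/
theorem LiftPair.mem_imageCone (h : LiftPair r ℓ lam E F G) (hr : 2 ≤ r) (hlam : 1 < lam)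
    (hτ : IsCr r τ) (R : ℝ) (n : ℕ) (ζ : Torus) (v : ℝ × ℝ) :
    v ∈ imageCone (skewProduct E τ) lam R n ζ ↔
      |cocycle E (onCircle (deriv F)) n ζ.1 * v.2
        + pull E (onCircle (deriv F)) (circleDeriv τ) n ζ.1 0 * v.1| ≤ R / (lam - 1) * |v.1| := by
  have hD := cocycle_pos (E := E) (by linarith) h.le_onCircle n ζ.1
  rw [imageCone, h.torusDeriv_skewProduct hr hτ]
  set D := cocycle E (onCircle (deriv F)) n ζ.1
  set p := pull E (onCircle (deriv F)) (circleDeriv τ) n ζ.1 0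
  constructor
  · rintro ⟨u, hu, rfl⟩
    rw [shear_apply]
    have e : D * (u.2 + -p * u.1) + p * (D * u.1) = D * u.2 := by ring
    simp only [e, abs_mul, abs_of_pos hD]
    have : |u.2| ≤ R / (lam - 1) * |u.1| := hu
    nlinarith
  · intro hv
    refine ⟨(v.1 / D, v.2 + p * (v.1 / D)), ?_, ?_⟩
    · change |v.2 + p * (v.1 / D)| ≤ R / (lam - 1) * |v.1 / D|
      have e : v.2 + p * (v.1 / D) = (D * v.2 + p * v.1) / D := by field_simp
      rw [e, abs_div, abs_div, abs_of_pos hD, ← mul_div_assoc]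
      gcongr
    · rw [shear_apply]
      ext <;> simp only <;> field_simp
      ring

theorem LiftPair.mem_imageCone_iff (h : LiftPair r ℓ lam E F G) (hr : 2 ≤ r) (hlam : 1 < lam)
    (hτ : IsCr r τ) (R : ℝ) (n : ℕ) (ζ : Torus) {v : ℝ × ℝ} (hv : v.1 ≠ 0) :
    v ∈ imageCone (skewProduct E τ) lam R n ζ ↔
      |pull E (onCircle (deriv F)) (circleDeriv τ) n ζ.1 (v.2 / v.1)| ≤ R / (lam - 1) := by
  rw [h.mem_imageCone hr hlam hτ,
    ← mul_le_mul_iff_left₀ (b := |pull E _ _ n ζ.1 _|) (abs_pos.2 hv), ← abs_mul]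
  have := pull_sub_pull E (onCircle (deriv F)) (circleDeriv τ) n ζ.1 (v.2 / v.1) 0
  rw [sub_eq_iff_eq_add] at this
  rw [this]
  have e : ∀ D p : ℝ, (D * (v.2 / v.1 - 0) + p) * v.1 = D * v.2 + p * v.1 := by
    intro D p; field_simp; ring
  rw [e]

theorem LiftPair.fst_ne_zero_of_mem (h : LiftPair r ℓ lam E F G) (hr : 2 ≤ r) (hlam : 1 < lam)
    (hτ : IsCr r τ) {R : ℝ} {n : ℕ} {ζ : Torus} {v : ℝ × ℝ} (hv : v ≠ 0)
    (hm : v ∈ imageCone (skewProduct E τ) lam R n ζ) : v.1 ≠ 0 := by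
  intro h0
  rw [h.mem_imageCone hr hlam hτ, h0] at hm
  have hD := cocycle_pos (E := E) (by linarith) h.le_onCircle n ζ.1
  simp only [mul_zero, add_zero, abs_zero, abs_nonpos_iff, mul_eq_zero, hD.ne', false_or] at hm
  exact hv (Prod.ext h0 hm)

theorem LiftPair.weight_eq (h : LiftPair r ℓ lam E F G) (hr : 2 ≤ r) (hlam : 1 < lam)
    (hτ : IsCr r τ) (n : ℕ) (ζ : Torus) :
    weight (skewProduct E τ) n ζ
      = cocycle E (fun y => ENNReal.ofReal (1 / onCircle (deriv F) y)) n ζ.1 := by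
  rw [weight, h.torusDeriv_skewProduct hr hτ, det_shear,
    ofReal_one_div_cocycle fun y => by linarith [h.le_onCircle y]]

/-- The iterate rotates each vertical circle, so a fibre over `z` projects bijectively onto the
fibre of `E^[n]` over `z.1`. -/
theorem exists_iterate_skewProduct (E : UnitAddCircle → UnitAddCircle) (τ : UnitAddCircle → ℝ)
    (n : ℕ) : ∃ S : UnitAddCircle → UnitAddCircle, ∀ ζ,
      (skewProduct E τ)^[n] ζ = (E^[n] ζ.1, ζ.2 + S ζ.1) := by
  induction n with
  | zero => exact ⟨0, fun ζ => by simp⟩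
  | succ n ih =>
    obtain ⟨S, hS⟩ := ih
    refine ⟨fun y => (τ y : UnitAddCircle) + S (E y), fun ζ => ?_⟩
    rw [Function.iterate_succ_apply, hS, Function.iterate_succ_apply]
    simp [skewProduct, add_assoc]

/-- Sums over a fibre of the skew product are sums over the corresponding fibre of the base. -/
theorem tsum_skewProduct_fiber (w : UnitAddCircle → ℝ≥0∞) (n : ℕ) (z : Torus)
    (P : UnitAddCircle → Prop) (Q : Torus → Prop) (hQ : ∀ ζ, Q ζ ↔ P ζ.1) :
    ∑' ζ : {ζ : Torus // (skewProduct E τ)^[n] ζ = z ∧ Q ζ}, cocycle E w n ζ.1.1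
      = fiberSum E w n P 1 z.1 := by
  classical
  obtain ⟨S, hS⟩ := exists_iterate_skewProduct E τ n
  let e : {ζ : Torus // (skewProduct E τ)^[n] ζ = z ∧ Q ζ} ≃
      {y : UnitAddCircle | E^[n] y = z.1 ∧ P y} :=
    { toFun := fun ζ => ⟨ζ.1.1, by
        have := ζ.2.1
        rw [hS] at this
        exact ⟨congrArg Prod.fst this, (hQ _).1 ζ.2.2⟩⟩
      invFun := fun y => ⟨(y.1, z.2 - S y.1), by
        rw [hS]
        exact ⟨Prod.ext y.2.1 (by simp), (hQ _).2 y.2.2⟩⟩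
      left_inv := fun ζ => by
        have := ζ.2.1
        rw [hS] at this
        have h2 : ζ.1.2 + S ζ.1.1 = z.2 := congrArg Prod.snd this
        ext
        · rfl
        · simp [← h2]
      right_inv := fun y => rfl }
  rw [show (fun ζ : {ζ : Torus // (skewProduct E τ)^[n] ζ = z ∧ Q ζ} => cocycle E w n ζ.1.1)
    = fun ζ => (fun y : {y : UnitAddCircle | E^[n] y = z.1 ∧ P y} => cocycle E w n y.1) (e ζ)
    from rfl, e.tsum_eq (fun y : {y : UnitAddCircle | E^[n] y = z.1 ∧ P y} => cocycle E w n y.1),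
    tsum_subtype {y : UnitAddCircle | E^[n] y = z.1 ∧ P y} (cocycle E w n), fiberSum]
  refine tsum_congr fun y => ?_
  simp [Set.indicator_apply]

/-- Vertical vectors lie in no image cone, and every slope is that of a unit vector. The weight is
left free to serve both the count and the weighted sum. -/
theorem LiftPair.iSup_cone_eq (h : LiftPair r ℓ lam E F G) (hr : 2 ≤ r) (hlam : 1 < lam)
    (hτ : IsCr r τ) (R : ℝ) (w : UnitAddCircle → ℝ≥0∞) (n : ℕ) :
    (⨆ (z : Torus) (v : ℝ × ℝ) (_ : v.1 ^ 2 + v.2 ^ 2 = 1),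
      ∑' ζ : {ζ : Torus // (skewProduct E τ)^[n] ζ = z ∧
        v ∈ imageCone (skewProduct E τ) lam R n ζ}, cocycle E w n ζ.1.1)
      = ⨆ (x) (σ), coneSum E w (onCircle (deriv F)) (circleDeriv τ) (R / (lam - 1)) n 1 x σ := by
  have key : ∀ (z : Torus) (v : ℝ × ℝ), v.1 ≠ 0 →
      ∑' ζ : {ζ : Torus // (skewProduct E τ)^[n] ζ = z ∧
        v ∈ imageCone (skewProduct E τ) lam R n ζ}, cocycle E w n ζ.1.1
      = coneSum E w (onCircle (deriv F)) (circleDeriv τ) (R / (lam - 1)) n 1 z.1 (v.2 / v.1) :=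
    fun z v hv => tsum_skewProduct_fiber w n z _ _
      fun ζ => h.mem_imageCone_iff hr hlam hτ R n ζ hv
  apply le_antisymm
  · refine iSup_le fun z => iSup₂_le fun v hv => ?_
    by_cases h0 : v.1 = 0
    · have hv0 : v ≠ 0 := by rintro rfl; simp at hv
      have : IsEmpty {ζ : Torus // (skewProduct E τ)^[n] ζ = z ∧
          v ∈ imageCone (skewProduct E τ) lam R n ζ} :=
        ⟨fun ζ => h.fst_ne_zero_of_mem hr hlam hτ hv0 ζ.2.2 h0⟩
      simp
    · rw [key z v h0]
      exact le_iSup₂ (f := fun x σ => coneSum E w (onCircle (deriv F)) (circleDeriv τ)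
        (R / (lam - 1)) n 1 x σ) _ _
  · refine iSup₂_le fun x σ => ?_
    have hs : 0 < √(1 + σ ^ 2) := Real.sqrt_pos.2 (by positivity)
    have hs2 : √(1 + σ ^ 2) ^ 2 = 1 + σ ^ 2 := Real.sq_sqrt (by positivity)
    have hv : (1 / √(1 + σ ^ 2)) ^ 2 + (σ / √(1 + σ ^ 2)) ^ 2 = 1 := by
      rw [div_pow, div_pow, hs2]
      field_simp
    have := key (x, 0) (1 / √(1 + σ ^ 2), σ / √(1 + σ ^ 2)) (by positivity)
    have e : σ / √(1 + σ ^ 2) / (1 / √(1 + σ ^ 2)) = σ := by field_simp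
    simp only [e] at this
    rw [← this]
    exact le_iSup_of_le (x, 0) (le_iSup₂_of_le (1 / √(1 + σ ^ 2), σ / √(1 + σ ^ 2)) hv le_rfl)

theorem LiftPair.weightedConeSum_eq (h : LiftPair r ℓ lam E F G) (hr : 2 ≤ r) (hlam : 1 < lam)
    (hτ : IsCr r τ) (R : ℝ) (n : ℕ) :
    weightedConeSum (skewProduct E τ) lam R n
      = ⨆ (x) (σ), coneSum E (fun y => ENNReal.ofReal (1 / onCircle (deriv F) y))
        (onCircle (deriv F)) (circleDeriv τ) (R / (lam - 1)) n 1 x σ := by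
  rw [weightedConeSum, ← h.iSup_cone_eq hr hlam hτ]
  simp_rw [h.weight_eq hr hlam hτ]

theorem LiftPair.coneCount_eq (h : LiftPair r ℓ lam E F G) (hr : 2 ≤ r) (hlam : 1 < lam)
    (hτ : IsCr r τ) (R : ℝ) (n : ℕ) :
    (coneCount (skewProduct E τ) lam R n : ℝ≥0∞)
      = ⨆ (x) (σ), coneSum E (fun _ => 1)
        (onCircle (deriv F)) (circleDeriv τ) (R / (lam - 1)) n 1 x σ := by
  rw [coneCount, ← h.iSup_cone_eq hr hlam hτ]
  simp_rw [ENat.toENNReal_iSup, ← ENNReal.tsum_set_one, cocycle_one]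
  rfl

theorem LiftPair.nonTransversalSum_eq (h : LiftPair r ℓ lam E F G) (hr : 2 ≤ r) (hlam : 1 < lam)
    (hτ : IsCr r τ) (R : ℝ) (n : ℕ) :
    nonTransversalSum (skewProduct E τ) lam R n
      = ⨆ x, fiberSum E (fun y => ENNReal.ofReal (1 / onCircle (deriv F) y)) n
        (fun y => ∃ σ, |pull E (onCircle (deriv F)) (circleDeriv τ) n y σ| ≤ R / (lam - 1) ∧
          |pull E (onCircle (deriv F)) (circleDeriv τ) n x σ| ≤ R / (lam - 1)) 1 (E^[n] x) := by
  have key : ∀ z w : Torus, ∑' ζ : {ζ : Torus // (skewProduct E τ)^[n] ζ = z ∧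
      imageCone (skewProduct E τ) lam R n ζ ∩ imageCone (skewProduct E τ) lam R n w ≠ {0}},
      weight (skewProduct E τ) n ζ
      = fiberSum E (fun y => ENNReal.ofReal (1 / onCircle (deriv F) y)) n
        (fun y => ∃ σ, |pull E (onCircle (deriv F)) (circleDeriv τ) n y σ| ≤ R / (lam - 1) ∧
          |pull E (onCircle (deriv F)) (circleDeriv τ) n w.1 σ| ≤ R / (lam - 1)) 1 z.1 := by
    intro z w
    simp_rw [h.weight_eq hr hlam hτ]
    refine tsum_skewProduct_fiber _ n z _ _ fun ζ => ?_
    have h0 : ∀ ζ, (0 : ℝ × ℝ) ∈ imageCone (skewProduct E τ) lam R n ζ := fun ζ => by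
      rw [h.mem_imageCone hr hlam hτ]
      simp
    constructor
    · intro hne
      have : ∃ v ∈ imageCone (skewProduct E τ) lam R n ζ ∩
          imageCone (skewProduct E τ) lam R n w, v ≠ 0 := by
        by_contra! hall
        exact hne (Set.eq_singleton_iff_unique_mem.2 ⟨⟨h0 ζ, h0 w⟩, hall⟩)
      obtain ⟨v, ⟨h1, h2⟩, hv⟩ := this
      have hv1 := h.fst_ne_zero_of_mem hr hlam hτ hv h1
      exact ⟨v.2 / v.1, (h.mem_imageCone_iff hr hlam hτ R n ζ hv1).1 h1,
        (h.mem_imageCone_iff hr hlam hτ R n w hv1).1 h2⟩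
    · rintro ⟨σ, h1, h2⟩ heq
      have hm : ((1, σ) : ℝ × ℝ) ∈ imageCone (skewProduct E τ) lam R n ζ ∩
          imageCone (skewProduct E τ) lam R n w :=
        ⟨(h.mem_imageCone_iff hr hlam hτ R n ζ (v := (1, σ)) one_ne_zero).2 (by simpa using h1),
          (h.mem_imageCone_iff hr hlam hτ R n w (v := (1, σ)) one_ne_zero).2 (by simpa using h2)⟩
      rw [heq] at hm
      simp at hm
  obtain ⟨S, hS⟩ := exists_iterate_skewProduct E τ n
  rw [nonTransversalSum]
  simp_rw [key]
  apply le_antisymm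
  · refine iSup_le fun z => iSup₂_le fun w hw => ?_
    have : z.1 = E^[n] w.1 := by rw [← hw, hS]
    rw [this]
    exact le_iSup_of_le w.1 le_rfl
  · refine iSup_le fun x => ?_
    refine le_iSup_of_le ((skewProduct E τ)^[n] (x, 0)) (le_iSup₂_of_le (x, 0) rfl ?_)
    rw [hS]

end SkewProducts

/-! ### Regularity for contracting twisted equations -/

section FunctionalEquation

/-- The terms of the series that solves `u = p * u ∘ G + g`. -/
def twistedTerm (G p g : ℝ → ℝ) : ℕ → ℝ → ℝ
  | 0, t => g t
  | n + 1, t => p t * twistedTerm G p g n (G t)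

variable {G p g u : ℝ → ℝ} {κ : ℝ}

theorem abs_twistedTerm_le (hκ0 : 0 < κ) (hp : ∀ t, |p t| ≤ κ) {A : ℝ} (hA : ∀ t, |g t| ≤ A)
    (n : ℕ) (t : ℝ) : |twistedTerm G p g n t| ≤ A * κ ^ n := by
  induction n generalizing t with
  | zero => simpa [twistedTerm] using hA t
  | succ n ih =>
    rw [twistedTerm, abs_mul, pow_succ, mul_comm (κ ^ n), mul_left_comm]
    exact mul_le_mul (hp t) (ih _) (abs_nonneg _) hκ0.le

/-- Unrolling the equation `N` times leaves a product of `N` values of `p` times a value of `u`, at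
most `B * κ ^ N`. -/
theorem hasSum_twistedTerm (hκ0 : 0 < κ) (hκ1 : κ < 1) (hp : ∀ t, |p t| ≤ κ) {A : ℝ}
    (hA : ∀ t, |g t| ≤ A) {B : ℝ} (hu : ∀ t, |u t| ≤ B) (heq : ∀ t, u t = p t * u (G t) + g t)
    (t : ℝ) : HasSum (fun n => twistedTerm G p g n t) (u t) := by
  have hS : Summable fun n => twistedTerm G p g n t :=
    Summable.of_norm_bounded ((summable_geometric_of_lt_one hκ0.le hκ1).mul_left A)
      (fun n => abs_twistedTerm_le hκ0 hp hA n t)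
  have hrem : ∀ N t, |∑ n ∈ Finset.range N, twistedTerm G p g n t - u t| ≤ B * κ ^ N := by
    intro N
    induction N with
    | zero => simpa using hu
    | succ N ih =>
      intro t
      have e : ∑ n ∈ Finset.range (N + 1), twistedTerm G p g n t - u t
          = p t * (∑ n ∈ Finset.range N, twistedTerm G p g n (G t) - u (G t)) := by
        rw [Finset.sum_range_succ', heq t, mul_sub, Finset.mul_sum]
        simp only [twistedTerm]
        ring
      rw [e, abs_mul, pow_succ, mul_comm (κ ^ N), mul_left_comm]
      exact mul_le_mul (hp t) (ih _) (abs_nonneg _) hκ0.le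
  have hlim : Tendsto (fun N => ∑ n ∈ Finset.range N, twistedTerm G p g n t) atTop (𝓝 (u t)) := by
    rw [tendsto_iff_norm_sub_tendsto_zero]
    refine squeeze_zero (fun _ => norm_nonneg _) (fun N => hrem N t) ?_
    simpa using (tendsto_pow_atTop_nhds_zero_of_lt_one hκ0.le hκ1).const_mul B
  exact (tendsto_nhds_unique hS.tendsto_sum_tsum_nat hlim) ▸ hS.hasSum

theorem contDiff_one_of_twisted_eq (hκ0 : 0 < κ) (hκ1 : κ < 1) (hG : ContDiff ℝ 1 G)
    (hG' : ∀ t, |deriv G t| ≤ κ) (hpc : ContDiff ℝ 1 p) (hgc : ContDiff ℝ 1 g)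
    (hp : ∀ t, |p t| ≤ κ) {A A' K B : ℝ} (hA : ∀ t, |g t| ≤ A) (hA' : ∀ t, |deriv g t| ≤ A')
    (hK : ∀ t, |deriv p t| ≤ K) (hu : ∀ t, |u t| ≤ B) (heq : ∀ t, u t = p t * u (G t) + g t) :
    ContDiff ℝ 1 u := by
  have hA0 : 0 ≤ A := (abs_nonneg _).trans (hA 0)
  have hA0' : 0 ≤ A' := (abs_nonneg _).trans (hA' 0)
  have hK0 : 0 ≤ K := (abs_nonneg _).trans (hK 0)
  have hf : ∀ n, ContDiff ℝ 1 (twistedTerm G p g n) := by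
    intro n
    induction n with
    | zero => exact hgc
    | succ n ih => exact hpc.mul (ih.comp hG)
  -- Chosen so that `A' ≤ M` starts the induction for `hf'` and `K * A ≤ M * κ` closes it, the
  -- derivative of `p` adding one to the linear factor.
  set M := A' + K * A / κ with hM
  have hM0 : 0 ≤ M := by positivity
  have hMK : K * A ≤ M * κ := by
    rw [hM, add_mul, div_mul_cancel₀ _ hκ0.ne']
    nlinarith
  have hf' : ∀ n t, |deriv (twistedTerm G p g n) t| ≤ M * ((n + 1) * κ ^ n) := by
    intro n
    induction n with
    | zero =>
      intro t
      have : deriv (twistedTerm G p g 0) t = deriv g t := rfl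
      rw [this]
      refine (hA' t).trans ?_
      have : 0 ≤ K * A / κ := by positivity
      simp [hM, this]
    | succ n ih =>
      intro t
      have h1 : HasDerivAt (twistedTerm G p g (n + 1)) (deriv p t * twistedTerm G p g n (G t)
          + p t * (deriv (twistedTerm G p g n) (G t) * deriv G t)) t :=
        ((hpc.differentiable one_ne_zero t).hasDerivAt).mul
          (((hf n).differentiable one_ne_zero (G t)).hasDerivAt.comp t
            (hG.differentiable one_ne_zero t).hasDerivAt)
      rw [h1.deriv]
      have h2 : |deriv p t * twistedTerm G p g n (G t)| ≤ K * (A * κ ^ n) := by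
        rw [abs_mul]
        exact mul_le_mul (hK t) (abs_twistedTerm_le hκ0 hp hA n _) (abs_nonneg _) hK0
      have h3 : |p t * (deriv (twistedTerm G p g n) (G t) * deriv G t)|
          ≤ κ * (M * ((n + 1) * κ ^ n) * 1) := by
        rw [abs_mul, abs_mul]
        have := (hG' t).trans hκ1.le
        gcongr
        · exact hp t
        · exact ih _
      refine (abs_add_le _ _).trans ((add_le_add h2 h3).trans ?_)
      have h4 : K * A * κ ^ n ≤ M * κ * κ ^ n := by gcongr
      push_cast
      rw [pow_succ]
      linarith
  have hsum : Summable fun n : ℕ => (A + M) * (((n : ℝ) + 1) * κ ^ n) := by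
    have h1 := summable_pow_mul_geometric_of_norm_lt_one 1
      (show ‖κ‖ < 1 by rwa [Real.norm_of_nonneg hκ0.le])
    have h2 := summable_geometric_of_lt_one hκ0.le hκ1
    simpa [add_mul] using (h1.add h2).mul_left (A + M)
  have hts : ContDiff ℝ ((1 : ℕ∞) : WithTop ℕ∞) fun t => ∑' n, twistedTerm G p g n t := by
    refine contDiff_tsum (v := fun _ (n : ℕ) => (A + M) * (((n : ℝ) + 1) * κ ^ n))
      (fun n => by exact_mod_cast hf n) (fun _ _ => hsum) ?_
    intro k n t hk
    have hκn : 0 ≤ κ ^ n := by positivity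
    have hk1 : k ≤ 1 := by exact_mod_cast hk
    rw [norm_iteratedFDeriv_eq_norm_iteratedDeriv]
    interval_cases k
    · rw [iteratedDeriv_zero]
      refine (abs_twistedTerm_le hκ0 hp hA n t).trans ?_
      have h1 : 0 ≤ A * (n * κ ^ n) := by positivity
      have h2 : 0 ≤ M * ((n + 1) * κ ^ n) := by positivity
      linarith
    · rw [iteratedDeriv_one]
      refine (hf' n t).trans ?_
      have h1 : 0 ≤ A * ((n + 1) * κ ^ n) := by positivity
      linarith
  have : u = fun t => ∑' n, twistedTerm G p g n t := by
    ext t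
    exact (hasSum_twistedTerm hκ0 hκ1 hp hA hu heq t).tsum_eq.symm
  rw [this]
  exact_mod_cast hts

/-- Bounded solutions of a contracting twisted cohomological equation are as regular as its
coefficients. -/
theorem contDiff_of_twisted_eq {c : ℝ} (hc : c ≠ 0) (hκ0 : 0 < κ) (hκ1 : κ < 1)
    (hG' : ∀ t, |deriv G t| ≤ κ) (hGc : ∀ t, G (t + c) = G t + 1)
    (hu1 : Function.Periodic u 1) {B : ℝ} (hu : ∀ t, |u t| ≤ B) (k : ℕ)
    (hG : ContDiff ℝ (k + 1) G) (hpc : ContDiff ℝ (k + 1) p) (hgc : ContDiff ℝ (k + 1) g)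
    (hpp : Function.Periodic p c) (hgp : Function.Periodic g c)
    (hp : ∀ t, |p t| ≤ κ) (heq : ∀ t, u t = p t * u (G t) + g t) :
    ContDiff ℝ (k + 1) u := by
  have base : ∀ {p g u : ℝ → ℝ} {B : ℝ}, ContDiff ℝ 1 G → ContDiff ℝ 1 p → ContDiff ℝ 1 g →
      Function.Periodic p c → Function.Periodic g c → (∀ t, |p t| ≤ κ) →
      (∀ t, |u t| ≤ B) → (∀ t, u t = p t * u (G t) + g t) → ContDiff ℝ 1 u := by
    intro p g u B hG hpc hgc hpp hgp hp hu heq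
    obtain ⟨A, -, hA⟩ := exists_abs_le_of_periodic hc hgp hgc.continuous
    obtain ⟨A', -, hA'⟩ := exists_abs_le_of_periodic hc
      (periodic_deriv (a := 0) fun t => by simpa using hgp t) (hgc.continuous_deriv le_rfl)
    obtain ⟨K, -, hK⟩ := exists_abs_le_of_periodic hc
      (periodic_deriv (a := 0) fun t => by simpa using hpp t) (hpc.continuous_deriv le_rfl)
    exact contDiff_one_of_twisted_eq hκ0 hκ1 hG hG' hpc hgc hp hA hA' hK hu heq
  induction k generalizing p g u B with
  | zero =>
    simp only [Nat.cast_zero, zero_add] at *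
    exact base hG hpc hgc hpp hgp hp hu heq
  | succ k ih =>
    have hle : ((k : WithTop ℕ∞) + 1) ≤ ((k + 1 : ℕ) : WithTop ℕ∞) + 1 := by
      norm_cast
      omega
    have hle1 : (1 : WithTop ℕ∞) ≤ ((k + 1 : ℕ) : WithTop ℕ∞) + 1 := by
      norm_cast
      omega
    have hu' := base (hG.of_le hle1) (hpc.of_le hle1) (hgc.of_le hle1) hpp hgp hp hu heq
    have hG1 := (contDiff_succ_iff_deriv.1 hG).2.2
    have hp1 := (contDiff_succ_iff_deriv.1 hpc).2.2
    have hg1 := (contDiff_succ_iff_deriv.1 hgc).2.2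
    -- The inhomogeneity of the differentiated equation contains `u ∘ G`, so the induction
    -- hypothesis is needed for `u` before it is applied to `deriv u`.
    have huk : ContDiff ℝ (k + 1) u :=
      ih hu1 hu (hG.of_le hle) (hpc.of_le hle) (hgc.of_le hle) hpp hgp hp heq
    have hder : ∀ t, deriv u t = p t * deriv G t * deriv u (G t)
        + (deriv p t * u (G t) + deriv g t) := by
      intro t
      have h1 : HasDerivAt u (deriv p t * u (G t) + p t * (deriv u (G t) * deriv G t)
          + deriv g t) t := by
        have := (((hpc.differentiable (by positivity) t).hasDerivAt).mul
          ((hu'.differentiable one_ne_zero (G t)).hasDerivAt.comp t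
            (hG.differentiable (by positivity) t).hasDerivAt)).add
          (hgc.differentiable (by positivity) t).hasDerivAt
        refine this.congr_of_eventuallyEq (Eventually.of_forall fun s => ?_)
        exact heq s
      rw [h1.deriv]
      ring
    obtain ⟨B', -, hB'⟩ := exists_abs_le_of_periodic one_ne_zero
      (periodic_deriv (a := 0) fun t => by simpa using hu1 t) (hu'.continuous_deriv le_rfl)
    have hGd : Function.Periodic (deriv G) c := periodic_deriv hGc
    have hpd' : Function.Periodic (deriv p) c :=
      periodic_deriv (a := 0) fun t => by simpa using hpp t
    have hgd' : Function.Periodic (deriv g) c :=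
      periodic_deriv (a := 0) fun t => by simpa using hgp t
    have hpk : ContDiff ℝ (k + 1) p := hpc.of_le hle
    have hGk : ContDiff ℝ (k + 1) G := hG.of_le hle
    push_cast at hG1 hp1 hg1 ⊢
    rw [contDiff_succ_iff_deriv]
    refine ⟨hu'.differentiable one_ne_zero, by simp, ?_⟩
    refine ih (p := fun t => p t * deriv G t) (g := fun t => deriv p t * u (G t) + deriv g t)
      (B := B') (periodic_deriv (a := 0) fun t => by simpa using hu1 t) hB' hGk
      (hpk.mul hG1) ((hp1.mul (huk.comp hGk)).add hg1) ?_ ?_ ?_ hder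
    · intro t
      simp only [hpp t, hGd t]
    · intro t
      simp only [hpd' t, hgd' t, hGc, hu1 (G t)]
    · intro t
      rw [abs_mul]
      calc |p t| * |deriv G t| ≤ κ * 1 :=
            mul_le_mul (hp t) ((hG' t).trans hκ1.le) (abs_nonneg _) hκ0.le
        _ = κ := mul_one κ

end FunctionalEquation

/-! ### Invariant slope fields and the cohomological equation -/

section Coherence

variable {r : ℕ∞} {ℓ : ℕ} {lam : ℝ} {E : UnitAddCircle → UnitAddCircle} {F G : ℝ → ℝ}
  {τ : UnitAddCircle → ℝ}

theorem LiftPair.deriv_inv (h : LiftPair r ℓ lam E F G) (hr : 2 ≤ r) (hlam : 1 < lam) (t : ℝ) :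
    deriv G t = 1 / deriv F (G t) := (h.hasDerivAt_inv hr hlam t).deriv

/-- A bounded invariant slope field integrates to a solution of the cohomological equation. -/
theorem LiftPair.isCohomologousToConst_of_slope (h : LiftPair r ℓ lam E F G) (hr : 2 ≤ r)
    (hlam : 1 < lam) (hℓ : 2 ≤ ℓ) (hτ : IsCr r τ) {a : UnitAddCircle → ℝ} {B : ℝ}
    (ha : ∀ y, |a y| ≤ B)
    (heq : ∀ y, a y = onCircle (deriv F) y * a (E y) - circleDeriv τ y) :
    IsCohomologousToConst r E τ := by
  set T : ℝ → ℝ := fun t => τ (t : UnitAddCircle) with hT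
  set u : ℝ → ℝ := fun t => a (t : UnitAddCircle) with hu
  have hTc : ContDiff ℝ r T := hτ
  have hT1 : Function.Periodic T 1 := fun t => by simp [hT]
  have hT'1 : Function.Periodic (deriv T) 1 :=
    periodic_deriv (a := 0) fun t => by simpa using hT1 t
  have hu1 : Function.Periodic u 1 := fun t => by simp [hu]
  have hFpos : ∀ t, 0 < deriv F t := fun t => by linarith [h.le_deriv t]
  -- Solved for the value at the image point, the expanding equation becomes contracting with factor
  -- `deriv G ≤ 1 / lam`.
  have hueq : ∀ t, u t = deriv G t * u (G t) + deriv G t * deriv T (G t) := by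
    intro t
    have h1 := heq (G t : UnitAddCircle)
    rw [onCircle_coe h.periodic, circleDeriv_coe, h.map_inv] at h1
    have h2 := (hFpos (G t)).ne'
    rw [h.deriv_inv hr hlam]
    simp only [hu]
    rw [h1]
    field_simp
    ring
  have hG'le : ∀ t, |deriv G t| ≤ 1 / lam := fun t => by
    rw [h.deriv_inv hr hlam, abs_of_pos (one_div_pos.2 (hFpos _))]
    exact one_div_le_one_div_of_le (by linarith) (h.le_deriv _)
  have hG'p : Function.Periodic (deriv G) ℓ := periodic_deriv h.inv_add_degree
  have hreg : ∀ k : ℕ, ((k + 2 : ℕ) : WithTop ℕ∞) ≤ r → ContDiff ℝ (k + 1) u := by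
    intro k hk
    have hk' : (k : WithTop ℕ∞) + 1 + 1 ≤ r := by
      refine le_trans (le_of_eq ?_) hk
      push_cast
      rw [add_assoc, one_add_one_eq_two]
    have hG2 := h.contDiff_inv.of_le hk'
    have hG1 := (contDiff_succ_iff_deriv.1 hG2).2.2
    have hT2 := (contDiff_succ_iff_deriv.1 (hTc.of_le hk')).2.2
    have hGk : ContDiff ℝ (k + 1) G := hG2.of_le (le_self_add)
    refine contDiff_of_twisted_eq (G := G) (c := ℓ) (κ := 1 / lam) (p := deriv G)
      (g := fun t => deriv G t * deriv T (G t)) (by positivity) (by positivity)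
      (by rw [div_lt_one] <;> linarith) hG'le h.inv_add_degree hu1 (fun t => ha _) k hGk hG1
      (hG1.mul (hT2.comp hGk)) hG'p ?_ hG'le hueq
    intro t
    simp only [hG'p t, h.inv_add_degree, hT'1 (G t)]
  have huc : Continuous u := (hreg 0 (by simpa using LiftPair.two_le hr)).continuous
  set φ : ℝ → ℝ := fun t => ∫ s in (0 : ℝ)..t, u s with hφ
  have hφ' : ∀ t, HasDerivAt φ (u t) t := fun t =>
    intervalIntegral.integral_hasDerivAt_right (huc.intervalIntegrable _ _)
      (huc.stronglyMeasurableAtFilter _ _) huc.continuousAt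
  have hφd : deriv φ = u := funext fun t => (hφ' t).deriv
  have hφc : ContDiff ℝ r φ := by
    have key : ∀ k : ℕ, ((k + 2 : ℕ) : WithTop ℕ∞) ≤ r →
        ContDiff ℝ ((k + 2 : ℕ) : WithTop ℕ∞) φ := by
      intro k hk
      have : ContDiff ℝ ((k : WithTop ℕ∞) + 1 + 1) φ := by
        rw [contDiff_succ_iff_deriv]
        refine ⟨fun t => (hφ' t).differentiableAt, by simp, ?_⟩
        rw [hφd]
        exact hreg k hk
      refine this.of_le (le_of_eq ?_)
      push_cast
      rw [add_assoc, one_add_one_eq_two]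
    rw [contDiff_iff_forall_nat_le]
    intro m hm
    rcases m with _ | _ | k
    · exact (key 0 (by simpa using LiftPair.two_le hr)).of_le (by norm_cast)
    · exact (key 0 (by simpa using LiftPair.two_le hr)).of_le (by norm_cast)
    · exact key k (by
        have : (((k + 2 : ℕ) : ℕ∞) : WithTop ℕ∞) ≤ r := WithTop.coe_le_coe.2 hm
        exact this)
  have hconst : ∀ (H : ℝ → ℝ), (∀ t, HasDerivAt H 0 t) → ∀ t, H t = H 0 := fun H hH t =>
    is_const_of_deriv_eq_zero (fun s => (hH s).differentiableAt) (fun s => (hH s).deriv) t 0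
  have hadd1 : ∀ t, φ (t + 1) = φ t + φ 1 := by
    intro t
    have h1 := hconst (fun t => φ (t + 1) - φ t) (fun t => by
      have := ((hφ' (t + 1)).comp_add_const t 1).sub (hφ' t)
      exact this.congr_deriv (by rw [hu1 t, sub_self])) t
    have h0 : φ 0 = 0 := by simp [hφ]
    simp only [zero_add, h0, sub_zero] at h1
    linarith
  have haddn : ∀ (n : ℕ) t, φ (t + n) = φ t + n * φ 1 := by
    intro n t
    induction n with
    | zero => simp
    | succ n ih =>
      push_cast
      rw [← add_assoc, hadd1, ih]
      ring
  have hH := hconst (fun t => φ (F t) - φ t - T t) (fun t => by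
    have h1 := (((hφ' (F t)).comp t (h.differentiable hr t).hasDerivAt).sub (hφ' t)).sub
      ((hTc.differentiable (LiftPair.ne_zero hr) t).hasDerivAt)
    refine h1.congr_deriv ?_
    have h2 := heq (t : UnitAddCircle)
    rw [onCircle_coe h.periodic, circleDeriv_coe, h.coe] at h2
    simp only [hu, h2]
    ring)
  -- Comparing the constant `φ ∘ F - φ - T` at `0` and `1` gives `(ℓ - 1) * φ 1 = 0`, so the
  -- primitive descends to the circle.
  have hφ1 : φ 1 = 0 := by
    have h1 := hH (0 + 1)
    simp only [h.map_add_one, haddn, hadd1, hT1 0] at h1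
    have h2 : ((ℓ : ℝ) - 1) * φ 1 = 0 := by linarith
    have h3 : (2 : ℝ) ≤ ℓ := by exact_mod_cast hℓ
    exact (mul_eq_zero.1 h2).resolve_left (by linarith)
  have hφp : Function.Periodic φ 1 := fun t => by rw [hadd1, hφ1, add_zero]
  refine ⟨onCircle φ, ?_, -(φ (F 0) - φ 0 - T 0), fun x => ?_⟩
  · unfold IsCr
    simp_rw [onCircle_coe hφp]
    exact hφc
  · rw [← coe_centeredRep x, h.coe, onCircle_coe hφp, onCircle_coe hφp]
    have := hH (centeredRep x)
    simp only [hT] at this ⊢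
    linarith

/-- The derivative of a solution of the cohomological equation is an invariant slope field
inside the cone. -/
theorem LiftPair.exists_slope_of_isCohomologousToConst (h : LiftPair r ℓ lam E F G)
    (hr : 2 ≤ r) (hlam : 1 < lam) (hcoh : IsCohomologousToConst r E τ) {θ : ℝ}
    (hb : ∀ y, |circleDeriv τ y| ≤ θ * (lam - 1)) :
    ∃ a : UnitAddCircle → ℝ, (∀ y, |a y| ≤ θ) ∧
      ∀ y, a y = onCircle (deriv F) y * a (E y) - circleDeriv τ y := by
  obtain ⟨φ, hφ, c, hc⟩ := hcoh
  have heq : ∀ y, circleDeriv φ y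
      = onCircle (deriv F) y * circleDeriv φ (E y) - circleDeriv τ y := by
    intro y
    rw [← coe_centeredRep y, h.coe, onCircle_coe h.periodic]
    simp only [circleDeriv_coe]
    set t := centeredRep y
    have hd := hφ.differentiable hr
    have e : (fun t : ℝ => τ (t : UnitAddCircle))
        = fun t : ℝ => φ (F t : UnitAddCircle) - φ (t : UnitAddCircle) + c := by
      ext s
      rw [hc, h.coe]
    have h1 := (((hd (F t)).hasDerivAt.comp t (h.differentiable hr t).hasDerivAt).sub
      (hd t).hasDerivAt).add_const c
    have h2 : HasDerivAt (fun t : ℝ => τ (t : UnitAddCircle)) _ t := e ▸ h1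
    rw [h2.deriv]
    ring
  refine ⟨circleDeriv φ, ?_, heq⟩
  have hcont := (hφ.continuous_circleDeriv hr).abs
  obtain ⟨y₀, -, hy₀⟩ := isCompact_univ.exists_isMaxOn Set.univ_nonempty hcont.continuousOn
  intro y
  refine (hy₀ (Set.mem_univ y)).trans ?_
  -- At a preimage of the maximum point, with maximum `M`, the equation gives `lam M ≤ M + θ (lam -
  -- 1)`, so `M ≤ θ`.
  obtain ⟨x, rfl⟩ : ∃ x, E x = y₀ := ⟨_, by
    rw [← coe_centeredRep y₀]
    exact h.map_inv _⟩
  have h1 : |circleDeriv φ x| ≤ |circleDeriv φ (E x)| := hy₀ (Set.mem_univ x)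
  have h2 := heq x
  have h3 : |onCircle (deriv F) x * circleDeriv φ (E x)|
      ≤ |circleDeriv φ x| + |circleDeriv τ x| := by
    rw [show onCircle (deriv F) x * circleDeriv φ (E x) = circleDeriv φ x + circleDeriv τ x by
      linarith]
    exact abs_add_le _ _
  have h4 := h.le_onCircle x
  rw [abs_mul, abs_of_pos (by linarith)] at h3
  have h5 := hb x
  simp only at *
  by_contra! hlt
  nlinarith [abs_nonneg (circleDeriv φ (E x))]

theorem pull_of_slope {X : Type*} {E : X → X} {d b a : X → ℝ}
    (ha : ∀ y, a y = d y * a (E y) - b y) (n : ℕ) (y : X) :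
    pull E d b n y (a (E^[n] y)) = a y := by
  induction n generalizing y with
  | zero => rfl
  | succ n ih => rw [pull, Function.iterate_succ_apply, ih, ← ha]

theorem continuous_pull {X : Type*} [TopologicalSpace X] {E : X → X} {d b : X → ℝ}
    (hE : Continuous E) (hd : Continuous d) (hb : Continuous b) (n : ℕ) :
    Continuous fun q : X × ℝ => pull E d b n q.1 q.2 := by
  induction n with
  | zero => exact continuous_snd
  | succ n ih =>
    have h1 : Continuous fun q : X × ℝ => pull E d b n (E q.1) q.2 :=
      ih.comp ((hE.comp continuous_fst).prodMk continuous_snd)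
    exact ((hd.comp continuous_fst).mul h1).sub (hb.comp continuous_fst)

/-- If at each level some slope over some point pulls back into all cones of the fibre, then there
is an invariant slope field inside the cone. -/
theorem LiftPair.exists_slope (h : LiftPair r ℓ lam E F G) (hr : 2 ≤ r) (hlam : 1 < lam)
    (hℓ : 2 ≤ ℓ) {b : UnitAddCircle → ℝ} (hbc : Continuous b) {θ : ℝ}
    (hb : ∀ y, |b y| ≤ θ * (lam - 1))
    (hall : ∀ N, ∃ x σ, ∀ y, E^[N] y = x → |pull E (onCircle (deriv F)) b N y σ| ≤ θ) :
    ∃ a : UnitAddCircle → ℝ, (∀ y, |a y| ≤ θ) ∧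
      ∀ y, a y = onCircle (deriv F) y * a (E y) - b y := by
  set d := onCircle (deriv F) with hd
  have hsurj : ∀ (n : ℕ) x, ∃ y, E^[n] y = x := fun n x =>
    ⟨(G^[n] (centeredRep x) : ℝ), by rw [h.iterate_map_inv, coe_centeredRep]⟩
  have hpull : ∀ {m n : ℕ} {x : UnitAddCircle} {σ : ℝ},
      (∀ y, E^[m + n] y = x → |pull E d b (m + n) y σ| ≤ θ) → ∀ y, E^[m] y = x →
      ∀ y', E^[n] y' = y → |pull E d b n y' (pull E d b m y σ)| ≤ θ := by
    intro m n x σ hx y hy y' hy'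
    rw [← hy', ← pull_add]
    exact hx y' (by rw [Function.iterate_add_apply, hy', hy])
  have hless : ∀ {m n : ℕ} {x : UnitAddCircle} {σ : ℝ},
      (∀ y, E^[m + n] y = x → |pull E d b (m + n) y σ| ≤ θ) → ∀ y, E^[m] y = x →
      |pull E d b m y σ| ≤ θ := by
    intro m n x σ hx y hy
    obtain ⟨y', rfl⟩ := hsurj n y
    exact abs_pull_le_of_add hlam h.le_onCircle hb
      (hx y' (by rw [Function.iterate_add_apply, hy]))
  have happrox : ∀ (T : ℝ) (N : ℕ), ∃ (T' σ : ℝ), |T' - T| ≤ 1 / lam ^ N ∧ |σ| ≤ θ ∧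
      ∀ y, E^[N] y = (T' : UnitAddCircle) → |pull E d b N y σ| ≤ θ := by
    intro T N
    -- The first `N` levels move the base point to within `1 / lam ^ N` of `T`; the other `N` retain
    -- the cone condition.
    obtain ⟨x, σ, hx⟩ := hall (N + N)
    set X := centeredRep x with hX
    set k := ⌊F^[N] T - X⌋
    have hfib : E^[N] (G^[N] (X + k) : UnitAddCircle) = x := by
      rw [h.iterate_map_inv, ← coe_centeredRep x, ← hX]
      have : ((k : ℝ) : UnitAddCircle) = 0 := (AddCircle.coe_eq_zero_iff 1).2 ⟨k, by simp⟩
      rw [AddCircle.coe_add, this, add_zero]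
    refine ⟨G^[N] (X + k), pull E d b N (G^[N] (X + k) : ℝ) σ, ?_, hless hx _ hfib,
      hpull hx _ hfib⟩
    conv_lhs => rw [← h.iterate_left_inv N T]
    refine (h.abs_iterate_inv_sub_le hr hlam N _ _).trans ?_
    gcongr
    rw [abs_le]
    have h1 := Int.floor_le (F^[N] T - X)
    have h2 := Int.lt_floor_add_one (F^[N] T - X)
    constructor <;> linarith
  have hcoh : ∀ x, ∃ σ, ∀ n y, E^[n] y = x → |pull E d b n y σ| ≤ θ := by
    intro x
    set T := centeredRep x with hT
    choose T' σ' h1 h2 h3 using happrox T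
    -- For each fixed level `n` the cone conditions are closed and hold along the fixed branches
    -- `G^[n] (· + k)`, so they pass to the limit.
    obtain ⟨σ, -, ψ, hψ, hlim⟩ := (isCompact_Icc (a := -θ) (b := θ)).tendsto_subseq
      (fun N => abs_le.1 (h2 N))
    have hT' : Tendsto T' atTop (𝓝 T) := by
      rw [tendsto_iff_norm_sub_tendsto_zero]
      refine squeeze_zero (fun _ => norm_nonneg _) h1 ?_
      simpa using tendsto_pow_atTop_nhds_zero_of_lt_one (r := lam⁻¹) (by positivity)
        (inv_lt_one_of_one_lt₀ hlam)
    refine ⟨σ, fun n y hy => ?_⟩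
    rw [← coe_centeredRep x, ← hT, h.iterate_eq_iff hℓ] at hy
    obtain ⟨k, hk, rfl⟩ := hy
    have hGc : Continuous fun t : ℝ => ((G^[n] (t + k) : ℝ) : UnitAddCircle) :=
      (AddCircle.continuous_mk' (1 : ℝ)).comp
        ((h.contDiff_inv.continuous.iterate n).comp (continuous_id.add continuous_const))
    have hy : Tendsto (fun N => ((G^[n] (T' (ψ N) + k) : ℝ) : UnitAddCircle)) atTop
        (𝓝 ((G^[n] (T + k) : ℝ) : UnitAddCircle)) :=
      (hGc.tendsto T).comp (hT'.comp hψ.tendsto_atTop)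
    have hcp := (continuous_pull (E := E) (d := d) (b := b) h.continuous_map
      (continuous_onCircle h.periodic (h.continuous_deriv hr)) hbc n).abs
    refine le_of_tendsto ((hcp.tendsto _).comp (hy.prodMk_nhds hlim)) ?_
    filter_upwards [eventually_ge_atTop n] with N hN
    have hge : n ≤ ψ N := hN.trans (hψ.id_le N)
    have h4 := h3 (ψ N)
    obtain ⟨m, hm⟩ := Nat.exists_eq_add_of_le hge
    have h5 : ∀ y, E^[n + m] y = (T' (ψ N) : UnitAddCircle) →
        |pull E d b (n + m) y (σ' (ψ N))| ≤ θ := by rw [← hm]; exact h4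
    exact hless h5 _ ((h.iterate_eq_iff hℓ n _ _).2 ⟨k, hk, rfl⟩)
  choose a ha using hcoh
  refine ⟨a, fun y => ha y 0 y rfl, fun y => ?_⟩
  have h1 : ∀ n y', E^[n] y' = y → |pull E d b n y' (d y * a (E y) - b y)| ≤ θ := by
    intro n y' hy'
    exact hpull (m := 1) (fun y'' hy'' => ha (E y) (1 + n) y'' hy'') y rfl y' hy'
  -- Two slopes admissible at all levels over `y` coincide, since pulling back `n` times stretches
  -- their difference by at least `lam ^ n` while both images stay in `[-θ, θ]`.
  by_contra hne
  have hpos : 0 < |a y - (d y * a (E y) - b y)| := abs_pos.2 (sub_ne_zero.2 hne)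
  obtain ⟨n, hn⟩ := pow_unbounded_of_one_lt (2 * θ / |a y - (d y * a (E y) - b y)|) hlam
  obtain ⟨y', hy'⟩ := hsurj n y
  have h2 := pull_sub_pull E d b n y' (a y) (d y * a (E y) - b y)
  have h3 := abs_sub (pull E d b n y' (a y)) (pull E d b n y' (d y * a (E y) - b y))
  have h4 := pow_le_cocycle (E := E) (by linarith) h.le_onCircle n y'
  have hD := cocycle_pos (E := E) (by linarith) h.le_onCircle n y'
  rw [h2, abs_mul, abs_of_pos hD] at h3
  rw [div_lt_iff₀ hpos] at hn
  have h5 := ha y n y' hy'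
  have h6 := h1 n y' hy'
  have h7 := mul_le_mul_of_nonneg_right h4 hpos.le
  linarith

end Coherence

/-! ### Exponential growth rates -/

section GrowthRates

theorem tendsto_const_rpow_one_div {C : ℝ≥0∞} (h0 : C ≠ 0) (hC : C ≠ ∞) :
    Tendsto (fun n : ℕ => C ^ (1 / (n : ℝ))) atTop (𝓝 1) := by
  have hpos : 0 < C.toReal := ENNReal.toReal_pos h0 hC
  have h1 : Tendsto (fun n : ℕ => C.toReal ^ (1 / (n : ℝ))) atTop (𝓝 1) := by
    have := (Real.continuous_const_rpow hpos.ne').tendsto 0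
    rw [Real.rpow_zero] at this
    exact this.comp tendsto_one_div_atTop_nhds_zero_nat
  have h2 := ENNReal.tendsto_ofReal h1
  rw [ENNReal.ofReal_one] at h2
  refine h2.congr fun n => ?_
  rw [← ENNReal.ofReal_rpow_of_pos hpos, ENNReal.ofReal_toReal hC]

theorem limsup_rpow_le_one {f : ℕ → ℝ≥0∞} {C : ℝ≥0∞} (h0 : C ≠ 0) (hC : C ≠ ∞)
    (hf : ∀ n, f n ≤ C) : limsup (fun n : ℕ => f n ^ (1 / (n : ℝ))) atTop ≤ 1 := by
  rw [← (tendsto_const_rpow_one_div h0 hC).limsup_eq]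
  exact limsup_le_limsup (Eventually.of_forall fun n => ENNReal.rpow_le_rpow (hf n) (by positivity))

theorem one_le_limsup_rpow {f : ℕ → ℝ≥0∞} {C : ℝ≥0∞} (h0 : C ≠ 0) (hC : C ≠ ∞)
    (hf : ∀ n, C ≤ f n) : 1 ≤ limsup (fun n : ℕ => f n ^ (1 / (n : ℝ))) atTop := by
  rw [← (tendsto_const_rpow_one_div h0 hC).limsup_eq]
  exact limsup_le_limsup (Eventually.of_forall fun n => ENNReal.rpow_le_rpow (hf n) (by positivity))

theorem limsup_rpow_lt_one {f : ℕ → ℝ≥0∞} {A q : ℝ≥0∞} (h0 : A ≠ 0) (hA : A ≠ ∞) (hq : q < 1)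
    {K n₀ : ℕ} (hK : 0 < K) (hf : ∀ n j, K * j + n₀ ≤ n → f n ≤ A * q ^ j) :
    limsup (fun n : ℕ => f n ^ (1 / (n : ℝ))) atTop < 1 := by
  set s : ℝ := 1 / (2 * K) with hs
  have hs0 : 0 < s := by positivity
  have hlim : Tendsto (fun n : ℕ => A ^ (1 / (n : ℝ)) * q ^ s) atTop (𝓝 (1 * q ^ s)) :=
    ENNReal.Tendsto.mul_const (tendsto_const_rpow_one_div h0 hA) (Or.inl one_ne_zero)
  refine lt_of_le_of_lt ?_ (show 1 * q ^ s < 1 by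
    rw [one_mul]; exact ENNReal.rpow_lt_one hq hs0)
  rw [← hlim.limsup_eq]
  refine limsup_le_limsup ?_
  filter_upwards [eventually_ge_atTop (2 * (n₀ + K))] with n hn
  -- For `n ≥ 2 * (n₀ + K)` this is at least `n / (2 * K)`, whence the exponent `s`.
  set j := (n - n₀) / K with hj
  have h1 : K * j + n₀ ≤ n := by
    have : K * j ≤ n - n₀ := Nat.mul_div_le (n - n₀) K
    omega
  have h2 : n ≤ 2 * K * j := by
    have : n - n₀ < K * (j + 1) := Nat.lt_mul_div_succ (n - n₀) hK
    rw [mul_add, mul_one] at this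
    rw [mul_assoc]
    omega
  have hn0 : 0 < n := by omega
  have h3 : s ≤ (j : ℝ) * (1 / (n : ℝ)) := by
    rw [hs, mul_one_div, div_le_div_iff₀ (by positivity) (by positivity), one_mul]
    have : (n : ℝ) ≤ ((2 * K * j : ℕ) : ℝ) := by exact_mod_cast h2
    push_cast at this
    linarith
  calc f n ^ (1 / (n : ℝ)) ≤ (A * q ^ j) ^ (1 / (n : ℝ)) :=
        ENNReal.rpow_le_rpow (hf n j h1) (by positivity)
    _ = A ^ (1 / (n : ℝ)) * q ^ ((j : ℝ) * (1 / (n : ℝ))) := by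
        rw [ENNReal.mul_rpow_of_nonneg _ _ (by positivity), ENNReal.rpow_mul, ENNReal.rpow_natCast]
    _ ≤ _ := mul_le_mul' le_rfl (ENNReal.rpow_le_rpow_of_exponent_ge hq.le h3)

/-- Fekete's lemma for submultiplicative sequences in `[1, ∞)`. -/
theorem exists_tendsto_rpow_of_submultiplicative {c : ℕ → ℝ≥0∞}
    (hsub : ∀ m n, c (m + n) ≤ c m * c n) (h1 : ∀ n, 1 ≤ c n) (hfin : ∀ n, c n ≠ ∞) :
    ∃ L, Tendsto (fun n : ℕ => c n ^ (1 / (n : ℝ))) atTop (𝓝 L) ∧ ∀ n, n ≠ 0 → L ^ n ≤ c n := by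
  have hc1 : ∀ n, 1 ≤ (c n).toReal := fun n => by
    simpa using ENNReal.toReal_mono (hfin n) (h1 n)
  have hc0 : ∀ n, 0 < (c n).toReal := fun n => by linarith [hc1 n]
  have hS : Subadditive fun n => Real.log (c n).toReal := by
    intro m n
    rw [← Real.log_mul (hc0 m).ne' (hc0 n).ne', ← ENNReal.toReal_mul]
    exact Real.log_le_log (hc0 _)
      (ENNReal.toReal_mono (ENNReal.mul_ne_top (hfin m) (hfin n)) (hsub m n))
  have hbdd : BddBelow (Set.range fun n : ℕ => Real.log (c n).toReal / n) :=
    ⟨0, by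
      rintro _ ⟨n, rfl⟩
      exact div_nonneg (Real.log_nonneg (hc1 n)) (Nat.cast_nonneg n)⟩
  refine ⟨ENNReal.ofReal (Real.exp hS.lim), ?_, fun n hn => ?_⟩
  · refine (ENNReal.tendsto_ofReal
      ((Real.continuous_exp.tendsto _).comp (hS.tendsto_lim hbdd))).congr fun n => ?_
    rw [Function.comp_apply, div_eq_mul_one_div, ← Real.rpow_def_of_pos (hc0 n),
      ← ENNReal.ofReal_rpow_of_pos (hc0 n), ENNReal.ofReal_toReal (hfin n)]
  · have h2 := hS.lim_le_div hbdd hn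
    have hn0 : (0 : ℝ) < n := by positivity
    rw [le_div_iff₀ hn0] at h2
    rw [← ENNReal.ofReal_pow (Real.exp_pos _).le, ← Real.exp_nat_mul,
      ← ENNReal.ofReal_toReal (hfin n)]
    apply ENNReal.ofReal_le_ofReal
    rw [← Real.exp_log (hc0 n)]
    apply Real.exp_le_exp.2
    linarith

end GrowthRates

/-! ### From non-transversality to a common slope -/

section NonTransversality

variable {X : Type*} {E : X → X} {d b : X → ℝ} {lam θ : ℝ}

/-- Points not transversal to `x₀` at level `m + n` have, at level `m`, slightly larger cones that
contain a common slope. -/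
theorem nonTransversal_fiberSum_le (hlam : 1 < lam) (hd : ∀ y, lam ≤ d y)
    (hb : ∀ y, |b y| ≤ θ * (lam - 1)) {Λ : ℝ} (hΛ : ∀ y, d y ≤ Λ) {w : X → ℝ≥0∞} {C S : ℝ≥0∞}
    {m n : ℕ} (hup : ∀ x, fiberSum E w n (fun _ => True) 1 x ≤ C)
    (hS : ∀ x σ, coneSum E w d b (θ + 1) m 1 x σ ≤ S)
    (hmn : Λ ^ m * (2 * θ) ≤ lam ^ (m + n)) (x₀ : X) :
    fiberSum E w (m + n) (fun y => ∃ σ, |pull E d b (m + n) y σ| ≤ θ ∧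
      |pull E d b (m + n) x₀ σ| ≤ θ) 1 (E^[m + n] x₀) ≤ S * C := by
  -- The central slope of the image cone of `x₀` serves all `y` at once. The shared slope `σ`
  -- differs from it by at most `θ / lam ^ (m + n)`, and only `m` pull-backs magnify this, by at
  -- most `Λ ^ m`, to less than the extra aperture `1`.
  obtain ⟨σ₀, hσ₀⟩ := exists_pull_eq_zero (E := E) (b := b) (by linarith) hd (m + n) x₀
  have hpos : ∀ n y, 0 < cocycle E d n y := fun n y => cocycle_pos (by linarith) hd n y
  have hΛ0 : 0 < Λ := by linarith [hd x₀, hΛ x₀]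
  calc _ ≤ fiberSum E w (m + n) (fun y => |pull E d b m (E^[n] y) σ₀| ≤ θ + 1 ∧ True) 1
        (E^[m + n] x₀) := by
        refine fiberSum_mono (fun y _ hy => ⟨?_, trivial⟩) (fun _ => le_rfl)
        obtain ⟨σ, h1, h2⟩ := hy
        have h3 := abs_pull_le_of_add hlam hd hb h1
        have h4 := pull_sub_pull E d b (m + n) x₀ σ σ₀
        have h5 := pull_sub_pull E d b m (E^[n] y) σ₀ σ
        rw [hσ₀, sub_zero] at h4
        rw [h4, abs_mul, abs_of_pos (hpos _ _)] at h2
        have h6 := pow_le_cocycle (E := E) (by linarith) hd (m + n) x₀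
        have h7 := cocycle_le_pow (E := E) (fun y => by linarith [hd y]) hΛ m (E^[n] y)
        have h8 : cocycle E d m (E^[n] y) * |σ₀ - σ| ≤ 1 := by
          have h10 : lam ^ (m + n) * |σ - σ₀| ≤ θ := by
            refine le_trans ?_ h2
            gcongr
          have h11 : 0 < lam ^ (m + n) := by positivity
          have hθ : 0 ≤ θ := (abs_nonneg _).trans h3
          refine (mul_le_mul_of_nonneg_right h7 (abs_nonneg _)).trans ?_
          rw [abs_sub_comm]
          have h12 : Λ ^ m * (lam ^ (m + n) * |σ - σ₀|) ≤ Λ ^ m * θ := by gcongr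
          have h13 : 0 ≤ Λ ^ m * θ := by positivity
          have h14 : lam ^ (m + n) * (Λ ^ m * |σ - σ₀|) ≤ lam ^ (m + n) * 1 := by linarith
          exact le_of_mul_le_mul_left h14 h11
        have h9 : |pull E d b m (E^[n] y) σ₀ - pull E d b m (E^[n] y) σ| ≤ 1 := by
          rw [h5, abs_mul, abs_of_pos (hpos _ _)]
          exact h8
        have h10 := abs_sub_abs_le_abs_sub (pull E d b m (E^[n] y) σ₀) (pull E d b m (E^[n] y) σ)
        linarith
    _ = fiberSum E w m (fun y => |pull E d b m y σ₀| ≤ θ + 1)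
        (fun y => fiberSum E w n (fun _ => True) 1 y) (E^[m + n] x₀) :=
        fiberSum_add w m n (fun y => |pull E d b m y σ₀| ≤ θ + 1) (fun _ _ => True) 1 _
    _ ≤ fiberSum E w m (fun y => |pull E d b m y σ₀| ≤ θ + 1) (fun y => (1 : X → ℝ≥0∞) y * C)
        (E^[m + n] x₀) :=
        fiberSum_mono (fun _ _ h => h) (fun y => by simpa using hup y)
    _ = coneSum E w d b (θ + 1) m 1 (E^[m + n] x₀) σ₀ * C := fiberSum_mul_const ..
    _ ≤ S * C := by
        gcongr
        exact hS _ _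

end NonTransversality

/-! ### The implications between the four conditions -/

namespace LiftPair

variable {r : ℕ∞} {ℓ : ℕ} {lam R : ℝ} {E : UnitAddCircle → UnitAddCircle} {F G : ℝ → ℝ}
  {τ : UnitAddCircle → ℝ}

theorem abs_circleDeriv_le_mul (hr : 2 ≤ r) (hlam : 1 < lam) (hτ : IsCr r τ)
    (hR : derivSupNorm τ < R) (y : UnitAddCircle) :
    |circleDeriv τ y| ≤ R / (lam - 1) * (lam - 1) := by
  rw [div_mul_cancel₀ _ (by linarith)]
  exact (hτ.abs_circleDeriv_le hr y).trans hR.le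

theorem aperture_nonneg (hlam : 1 < lam) (hR : derivSupNorm τ < R) : 0 ≤ R / (lam - 1) :=
  div_nonneg ((Real.iSup_nonneg fun _ => abs_nonneg _).trans hR.le) (by linarith)

theorem fiberSum_one (h : LiftPair r ℓ lam E F G) (hℓ : 2 ≤ ℓ) (n : ℕ) (x : UnitAddCircle) :
    fiberSum E (fun _ => 1) n (fun _ => True) 1 x = (ℓ : ℝ≥0∞) ^ n := by
  simp only [fiberSum, and_true, cocycle_one, Pi.one_apply, mul_one]
  have := h.tsum_fiber hℓ n (centeredRep x) (fun _ => 1)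
  rw [coe_centeredRep] at this
  rw [this]
  simp

theorem coneCount_le (h : LiftPair r ℓ lam E F G) (hr : 2 ≤ r) (hlam : 1 < lam) (hℓ : 2 ≤ ℓ)
    (hτ : IsCr r τ) (n : ℕ) :
    (coneCount (skewProduct E τ) lam R n : ℝ≥0∞) ≤ (ℓ : ℝ≥0∞) ^ n := by
  rw [h.coneCount_eq hr hlam hτ]
  refine iSup₂_le fun x σ => ?_
  rw [← h.fiberSum_one hℓ n x]
  exact fiberSum_mono (fun _ _ _ => trivial) fun _ => le_rfl

theorem one_le_coneCount (h : LiftPair r ℓ lam E F G) (hr : 2 ≤ r) (hlam : 1 < lam)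
    (hτ : IsCr r τ) (hR : derivSupNorm τ < R) (n : ℕ) :
    1 ≤ (coneCount (skewProduct E τ) lam R n : ℝ≥0∞) := by
  rw [h.coneCount_eq hr hlam hτ]
  obtain ⟨σ, hσ⟩ := exists_pull_eq_zero (E := E) (b := circleDeriv τ) (by linarith)
    h.le_onCircle n 0
  refine le_iSup₂_of_le (E^[n] 0) σ (le_trans ?_ (ENNReal.le_tsum 0))
  have h0 : |pull E (onCircle (deriv F)) (circleDeriv τ) n 0 σ| ≤ R / (lam - 1) := by
    rw [hσ, abs_zero]
    exact aperture_nonneg hlam hR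
  rw [if_pos ⟨rfl, h0⟩, cocycle_one]
  simp

theorem exists_coneCountRate (h : LiftPair r ℓ lam E F G) (hr : 2 ≤ r) (hlam : 1 < lam)
    (hℓ : 2 ≤ ℓ) (hτ : IsCr r τ) (hR : derivSupNorm τ < R) :
    Tendsto (fun n : ℕ => (coneCount (skewProduct E τ) lam R n : ℝ≥0∞) ^ (1 / (n : ℝ))) atTop
        (𝓝 (coneCountRate (skewProduct E τ) lam R)) ∧
      ∀ n, n ≠ 0 → coneCountRate (skewProduct E τ) lam R ^ n
        ≤ (coneCount (skewProduct E τ) lam R n : ℝ≥0∞) := by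
  obtain ⟨L, hL, hle⟩ := exists_tendsto_rpow_of_submultiplicative
    (c := fun n => (coneCount (skewProduct E τ) lam R n : ℝ≥0∞))
    (fun m n => by
      simp only [h.coneCount_eq hr hlam hτ]
      exact coneSum_one_add_le hlam h.le_onCircle (abs_circleDeriv_le_mul hr hlam hτ hR) m n)
    (h.one_le_coneCount hr hlam hτ hR)
    (fun n => ((h.coneCount_le hr hlam hℓ hτ n).trans_lt (by simp)).ne)
  have : coneCountRate (skewProduct E τ) lam R = L := hL.limUnder_eq
  rw [this]
  exact ⟨hL, hle⟩

theorem isCohomologousToConst_of_coneCountRate_eq (h : LiftPair r ℓ lam E F G) (hr : 2 ≤ r)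
    (hlam : 1 < lam) (hℓ : 2 ≤ ℓ) (hτ : IsCr r τ) (hR : derivSupNorm τ < R)
    (hrate : coneCountRate (skewProduct E τ) lam R = (ℓ : ℝ≥0∞)) :
    IsCohomologousToConst r E τ := by
  have hb := abs_circleDeriv_le_mul hr hlam hτ hR
  obtain ⟨a, ha, heq⟩ := h.exists_slope hr hlam hℓ (hτ.continuous_circleDeriv hr) hb (fun N => by
    rcases eq_or_ne N 0 with rfl | hN
    -- Level zero is separate: the Fekete bound is only available for `n ≠ 0`.
    · exact ⟨0, 0, fun y _ => by simpa [pull] using aperture_nonneg hlam hR⟩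
    by_contra! hall
    have h1 := (h.exists_coneCountRate hr hlam hℓ hτ hR).2 N hN
    -- Fekete's limit is an infimum, so rate `ℓ` forces the full count `ℓ ^ N` at each level; one
    -- missing preimage for every slope contradicts this.
    rw [hrate, h.coneCount_eq hr hlam hτ] at h1
    have h2 : ∀ x σ, coneSum E (fun _ => 1) (onCircle (deriv F)) (circleDeriv τ)
        (R / (lam - 1)) N 1 x σ ≤ (ℓ : ℝ≥0∞) ^ N - 1 := by
      intro x σ
      obtain ⟨y, hy, hlt⟩ := hall x σ
      have h3 := coneSum_add_le_fiberSum (w := fun _ => 1) hy hlt 1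
      rw [cocycle_one, h.fiberSum_one hℓ] at h3
      exact ENNReal.le_sub_of_add_le_right (by simp) (by simpa using h3)
    have h3 := h1.trans (iSup₂_le h2)
    refine absurd h3 (not_le.2 (ENNReal.sub_lt_self (by simp) ?_ one_ne_zero))
    have : (ℓ : ℝ≥0∞) ≠ 0 := by
      simp only [ne_eq, Nat.cast_eq_zero]
      omega
    exact pow_ne_zero _ this)
  exact h.isCohomologousToConst_of_slope hr hlam hℓ hτ ha heq

/-- The invariant slope `a x` pulls back to `a y` at each preimage `y`, hence into every cone, and
no term is lost. -/
theorem fiberSum_le_coneSum_of_slope {θ : ℝ} {d a b : UnitAddCircle → ℝ}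
    (ha : ∀ y, |a y| ≤ θ) (heq : ∀ y, a y = d y * a (E y) - b y)
    (w : UnitAddCircle → ℝ≥0∞) (n : ℕ) (x : UnitAddCircle) :
    fiberSum E w n (fun _ => True) 1 x ≤ coneSum E w d b θ n 1 x (a x) :=
  fiberSum_mono (fun y hy _ => by rw [← hy, pull_of_slope heq]; exact ha y) fun _ => le_rfl

theorem coneCountRate_eq_of_isCohomologousToConst (h : LiftPair r ℓ lam E F G) (hr : 2 ≤ r)
    (hlam : 1 < lam) (hℓ : 2 ≤ ℓ) (hτ : IsCr r τ) (hR : derivSupNorm τ < R)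
    (hcoh : IsCohomologousToConst r E τ) :
    coneCountRate (skewProduct E τ) lam R = (ℓ : ℝ≥0∞) := by
  obtain ⟨a, ha, heq⟩ := h.exists_slope_of_isCohomologousToConst hr hlam hcoh
    (abs_circleDeriv_le_mul hr hlam hτ hR)
  have hc : ∀ n, (coneCount (skewProduct E τ) lam R n : ℝ≥0∞) = (ℓ : ℝ≥0∞) ^ n := fun n => by
    refine le_antisymm (h.coneCount_le hr hlam hℓ hτ n) ?_
    rw [h.coneCount_eq hr hlam hτ, ← h.fiberSum_one hℓ n 0]
    exact le_iSup₂_of_le 0 (a 0) (fiberSum_le_coneSum_of_slope ha heq _ n 0)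
  refine tendsto_nhds_unique (h.exists_coneCountRate hr hlam hℓ hτ hR).1
    (tendsto_const_nhds.congr' ?_)
  filter_upwards [eventually_gt_atTop 0] with n hn
  rw [hc, ← ENNReal.rpow_natCast, ← ENNReal.rpow_mul, mul_one_div_cancel (by positivity),
    ENNReal.rpow_one]

theorem nonTransversalSum_le (h : LiftPair r ℓ lam E F G) (hr : 2 ≤ r) (hlam : 1 < lam)
    (hτ : IsCr r τ) {C : ℝ≥0∞}
    (hup : ∀ n x, fiberSum E (fun y => ENNReal.ofReal (1 / onCircle (deriv F) y)) n
        (fun _ => True) 1 x ≤ C) (n : ℕ) :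
    nonTransversalSum (skewProduct E τ) lam R n ≤ C := by
  rw [h.nonTransversalSum_eq hr hlam hτ]
  exact iSup_le fun x => (fiberSum_mono (fun _ _ _ => trivial) fun _ => le_rfl).trans (hup n _)

/-- Any one point whose image cone contains the slope can serve as reference: all the others share
that slope with it. -/
theorem weightedConeSum_le_nonTransversalSum (h : LiftPair r ℓ lam E F G) (hr : 2 ≤ r)
    (hlam : 1 < lam) (hτ : IsCr r τ) (n : ℕ) :
    weightedConeSum (skewProduct E τ) lam R n ≤ nonTransversalSum (skewProduct E τ) lam R n := by
  rw [h.nonTransversalSum_eq hr hlam hτ, h.weightedConeSum_eq hr hlam hτ]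
  refine iSup₂_le fun x σ => ?_
  by_cases hw : ∃ w, E^[n] w = x ∧
      |pull E (onCircle (deriv F)) (circleDeriv τ) n w σ| ≤ R / (lam - 1)
  · obtain ⟨w, rfl, hw⟩ := hw
    exact le_iSup_of_le w (fiberSum_mono (fun y _ hy => ⟨σ, hy, hw⟩) fun _ => le_rfl)
  · refine le_of_eq_of_le ?_ zero_le
    exact ENNReal.tsum_eq_zero.2 fun y => if_neg fun hy => hw ⟨y, hy⟩

theorem weightedConeRate_eq_one_of_isCohomologousToConst (h : LiftPair r ℓ lam E F G)
    (hr : 2 ≤ r) (hlam : 1 < lam) (hℓ : 2 ≤ ℓ) (hτ : IsCr r τ) (hR : derivSupNorm τ < R)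
    (hcoh : IsCohomologousToConst r E τ) :
    weightedConeRate (skewProduct E τ) lam R = 1 := by
  obtain ⟨a, ha, heq⟩ := h.exists_slope_of_isCohomologousToConst hr hlam hcoh
    (abs_circleDeriv_le_mul hr hlam hτ hR)
  obtain ⟨C, hC, hC0, hup, hlo⟩ := h.exists_transfer_bounds hr hlam hℓ
  refine le_antisymm (limsup_rpow_le_one hC0 hC fun n =>
    (h.weightedConeSum_le_nonTransversalSum hr hlam hτ n).trans
      (h.nonTransversalSum_le hr hlam hτ hup n))
    (one_le_limsup_rpow (ENNReal.inv_ne_zero.2 hC) (ENNReal.inv_ne_top.2 hC0) fun n => ?_)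
  rw [h.weightedConeSum_eq hr hlam hτ]
  exact (hlo n 0).trans (le_iSup₂_of_le 0 (a 0) (fiberSum_le_coneSum_of_slope ha heq _ n 0))

theorem nonTransversalRate_eq_one (h : LiftPair r ℓ lam E F G) (hr : 2 ≤ r) (hlam : 1 < lam)
    (hℓ : 2 ≤ ℓ) (hτ : IsCr r τ) (hrate : weightedConeRate (skewProduct E τ) lam R = 1) :
    nonTransversalRate (skewProduct E τ) lam R = 1 := by
  obtain ⟨C, hC, hC0, hup, -⟩ := h.exists_transfer_bounds hr hlam hℓ
  refine le_antisymm (limsup_rpow_le_one hC0 hC (h.nonTransversalSum_le hr hlam hτ hup)) ?_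
  rw [← hrate]
  exact limsup_le_limsup (Eventually.of_forall fun n => ENNReal.rpow_le_rpow
    (h.weightedConeSum_le_nonTransversalSum hr hlam hτ n) (by positivity))

theorem nonTransversalRate_lt_one (h : LiftPair r ℓ lam E F G) (hr : 2 ≤ r) (hlam : 1 < lam)
    (hℓ : 2 ≤ ℓ) (hτ : IsCr r τ) (hR : derivSupNorm τ < R)
    (hcoh : ¬IsCohomologousToConst r E τ) :
    nonTransversalRate (skewProduct E τ) lam R < 1 := by
  set θ := R / (lam - 1)
  have hb := abs_circleDeriv_le_mul hr hlam hτ hR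
  have hb' : ∀ y, |circleDeriv τ y| ≤ (θ + 1) * (lam - 1) := fun y => by
    refine (hb y).trans ?_
    gcongr
    linarith
  -- The slope field may be sought in the wider cone `θ + 1`, since integrating it only requires
  -- boundedness.
  have hN : ∃ N, ∀ x σ, ∃ y, E^[N] y = x ∧
      θ + 1 < |pull E (onCircle (deriv F)) (circleDeriv τ) N y σ| := by
    by_contra! hall
    obtain ⟨a, ha, heq⟩ := h.exists_slope hr hlam hℓ (hτ.continuous_circleDeriv hr) hb' hall
    exact hcoh (h.isCohomologousToConst_of_slope hr hlam hℓ hτ ha heq)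
  obtain ⟨N, hN⟩ := hN
  obtain ⟨C, hC, hC0, hup, hlo⟩ := h.exists_transfer_bounds hr hlam hℓ
  obtain ⟨Λ, hΛ0, hΛ⟩ := exists_abs_le_of_periodic one_ne_zero h.periodic (h.continuous_deriv hr)
  have hΛd : ∀ y, onCircle (deriv F) y ≤ Λ := fun y => (le_abs_self _).trans (hΛ _)
  obtain ⟨u, hu1, hu2, q, hq, hcontr⟩ := exists_coneSum_contraction (θ := θ + 1)
    (d := onCircle (deriv F)) (b := circleDeriv τ) hC hC0
    (κ := ENNReal.ofReal (1 / Λ)) (by simpa using hΛ0)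
    (fun y => ENNReal.ofReal_le_ofReal (one_div_le_one_div_of_le
      (by linarith [h.le_onCircle y]) (hΛd y))) hup hlo hN
  have hS : ∀ j x σ, coneSum E (fun y => ENNReal.ofReal (1 / onCircle (deriv F) y))
      (onCircle (deriv F)) (circleDeriv τ) (θ + 1) (j * N) 1 x σ ≤ C * q ^ j * C := by
    intro j x σ
    have h1 := coneSum_mul_le hlam h.le_onCircle hb' hcontr j x σ
    calc _ ≤ coneSum E (fun y => ENNReal.ofReal (1 / onCircle (deriv F) y))
          (onCircle (deriv F)) (circleDeriv τ) (θ + 1) (j * N) (fun y => u y * C) x σ := by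
          refine fiberSum_mono (fun _ _ hy => hy) fun y => ?_
          rw [Pi.one_apply, ← ENNReal.inv_mul_cancel hC0 hC]
          gcongr
          exact hu2 y
      _ = coneSum E (fun y => ENNReal.ofReal (1 / onCircle (deriv F) y))
          (onCircle (deriv F)) (circleDeriv τ) (θ + 1) (j * N) u x σ * C := fiberSum_mul_const ..
      _ ≤ _ := by
          gcongr
          exact h1.trans (by gcongr; exact hu1 x)
  obtain ⟨p, hp⟩ := pow_unbounded_of_one_lt Λ hlam
  obtain ⟨n₀, hn₀⟩ := pow_unbounded_of_one_lt (2 * θ) hlam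
  -- With `Λ < lam ^ p` and `2 * θ < lam ^ n₀`, a level `n ≥ (p + 1) * (j * N) + n₀` leaves room for
  -- `j` contracting blocks and for the magnification bound. The final `+ 1` only keeps `K`
  -- positive.
  refine limsup_rpow_lt_one (A := C * C * C) (q := q) (K := (p + 1) * N + 1) (n₀ := n₀)
    (by simp [hC0]) (by finiteness) hq (by positivity) fun n j hn => ?_
  have hjN : (p + 1) * (j * N) + n₀ ≤ n := by
    refine le_trans ?_ hn
    have e : ((p + 1) * N + 1) * j = (p + 1) * (j * N) + j := by ring
    omega
  obtain ⟨m, rfl⟩ : ∃ m, n = j * N + m :=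
    Nat.exists_eq_add_of_le (by nlinarith [Nat.zero_le (p * (j * N))])
  rw [h.nonTransversalSum_eq hr hlam hτ]
  refine iSup_le fun x => (nonTransversal_fiberSum_le hlam h.le_onCircle hb hΛd (hup m)
    (hS j) ?_ x).trans (le_of_eq (by ring))
  calc Λ ^ (j * N) * (2 * θ) ≤ (lam ^ p) ^ (j * N) * lam ^ n₀ := by
        have := aperture_nonneg hlam hR
        gcongr
    _ = lam ^ (p * (j * N) + n₀) := by rw [← pow_mul, ← pow_add]
    _ ≤ lam ^ (j * N + m) := by
        apply pow_le_pow_right₀ hlam.le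
        nlinarith

end LiftPair

end PartialCaptivity

theorem mainTheorem2 (r : ℕ∞) (hr : 2 ≤ r) (ℓ : ℕ) (hℓ : 2 ≤ ℓ) (lam : ℝ) (hlam : 1 < lam)
    (E : UnitAddCircle → UnitAddCircle) (hE : PartialCaptivity.IsExpandingMap r ℓ lam E)
    (τ : UnitAddCircle → ℝ) (hτ : PartialCaptivity.IsCr r τ)
    (R : ℝ) (hR : PartialCaptivity.derivSupNorm τ < R) :
    Tendsto
        (fun n : ℕ =>
          (PartialCaptivity.coneCount (PartialCaptivity.skewProduct E τ) lam R n : ℝ≥0∞) ^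
            (1 / (n : ℝ)))
        atTop (𝓝 (PartialCaptivity.coneCountRate (PartialCaptivity.skewProduct E τ) lam R)) ∧
      [PartialCaptivity.IsCohomologousToConst r E τ,
        PartialCaptivity.nonTransversalRate (PartialCaptivity.skewProduct E τ) lam R = 1,
        PartialCaptivity.weightedConeRate (PartialCaptivity.skewProduct E τ) lam R = 1,
        PartialCaptivity.coneCountRate (PartialCaptivity.skewProduct E τ) lam R = (ℓ : ℝ≥0∞)].TFAE :=
  by
  obtain ⟨F, G, h⟩ := hE.exists_liftPair hr hlam
  refine ⟨(h.exists_coneCountRate hr hlam hℓ hτ hR).1, ?_⟩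
  tfae_have 1 → 3 := h.weightedConeRate_eq_one_of_isCohomologousToConst hr hlam hℓ hτ hR
  tfae_have 3 → 2 := h.nonTransversalRate_eq_one hr hlam hℓ hτ
  tfae_have 2 → 1 := fun h2 => by
    by_contra hcoh
    exact (h.nonTransversalRate_lt_one hr hlam hℓ hτ hR hcoh).ne h2
  tfae_have 1 → 4 := h.coneCountRate_eq_of_isCohomologousToConst hr hlam hℓ hτ hR
  tfae_have 4 → 1 := h.isCohomologousToConst_of_coneCountRate_eq hr hlam hℓ hτ hR
  tfae_finish
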